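/- Let $P$ be a finite set of points in the Euclidean plane, no three of them collinear. Let $CH(P)$ denote the boundary of the convex hull of $P$, and $|CH(P)|$ the number of points of $P$ lying on it. A \emph{triangulation} of $P$ is a plane graph $T$ with vertex set $P$ whose edges are line segments, such that the boundary of the outer face is $CH(P)$ and every other face is bounded by a triangle formed by three edges of $T$. A \emph{chord} of $T$ is an edge connecting two points of $P$ that lie on $CH(P)$ but are not consecutive on it. A \emph{complex triangle} of $T$ is a triangle formed by three edges of $T$ that contains a point of $P$ in its interior and another point of $P$ in its exterior. $T$ is \emph{noncomplex} if it has neither chords nor complex triangles. If $|CH(P)| \ge 4$, then $P$ admits a noncomplex triangulation if and only if at least one point of $P$ does not lie on $CH(P)$. -/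

import Mathlib

/-- The Euclidean plane. -/
abbrev Plane : Type := EuclideanSpace ℝ (Fin 2)

namespace PlanarPointSet

/-- No three distinct points of `P` are collinear. -/
def GeneralPosition (P : Finset Plane) : Prop :=
  ∀ a ∈ P, ∀ b ∈ P, ∀ c ∈ P, a ≠ b → a ≠ c → b ≠ c → ¬ Collinear ℝ ({a, b, c} : Set Plane)

/-- `CH(P)`: the boundary of the convex hull of `P`. -/
def CH (P : Finset Plane) : Set Plane :=
  frontier (convexHull ℝ (P : Set Plane))

/-- The points of `P` that lie on `CH(P)`. -/
def hullPoints (P : Finset Plane) : Set Plane :=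
  {p | p ∈ P ∧ p ∈ CH P}

/-- `|CH(P)|`: the number of points of `P` on `CH(P)`. -/
noncomputable def hullSize (P : Finset Plane) : ℕ :=
  (hullPoints P).ncard

/-- The straight-line drawing of a graph with vertex set `P`: all vertices, together with the
line segments that represent the edges. -/
def drawing (P : Finset Plane) (T : SimpleGraph P) : Set Plane :=
  (P : Set Plane) ∪ {x | ∃ a b : P, T.Adj a b ∧ x ∈ segment ℝ (a : Plane) (b : Plane)}

/-- The straight-line drawing of `T` is a plane graph: an edge passes through no vertex other than
its endpoints, and two distinct edges meet at most in common endpoints. -/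
def IsPlane (P : Finset Plane) (T : SimpleGraph P) : Prop :=
  (∀ a b : P, T.Adj a b → ∀ p : P, (p : Plane) ∈ segment ℝ (a : Plane) (b : Plane) →
      p = a ∨ p = b) ∧
  (∀ a b c d : P, T.Adj a b → T.Adj c d → s(a, b) ≠ s(c, d) →
      ∀ x : Plane, x ∈ segment ℝ (a : Plane) (b : Plane) → x ∈ segment ℝ (c : Plane) (d : Plane) →
        (x = a ∨ x = b) ∧ (x = c ∨ x = d))

/-- A face of the drawing: a connected component of its complement in the plane. -/
def IsFace (P : Finset Plane) (T : SimpleGraph P) (F : Set Plane) : Prop :=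
  ∃ x ∈ (drawing P T)ᶜ, F = connectedComponentIn (drawing P T)ᶜ x

/-- `a`, `b`, `c` are the vertices of a triangle formed by three edges of `T`. -/
def IsTriangleOf (P : Finset Plane) (T : SimpleGraph P) (a b c : P) : Prop :=
  T.Adj a b ∧ T.Adj b c ∧ T.Adj a c

/-- The closed triangular region with vertices `a`, `b`, `c`. -/
def triangleRegion (a b c : Plane) : Set Plane :=
  convexHull ℝ ({a, b, c} : Set Plane)

/-- `T` is a triangulation of `P`: a plane graph with vertex set `P` and straight edges, in which
the boundary of the outer (unbounded) face is `CH(P)` and every other face is bounded by a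
triangle formed by three edges. -/
structure IsTriangulation (P : Finset Plane) (T : SimpleGraph P) : Prop where
  isPlane : IsPlane P T
  outer : ∀ F, IsFace P T F → ¬ Bornology.IsBounded F → frontier F = CH P
  inner : ∀ F, IsFace P T F → Bornology.IsBounded F →
    ∃ a b c : P, IsTriangleOf P T a b c ∧ frontier F = frontier (triangleRegion a b c)

/-- `a` and `b` are consecutive on `CH(P)`: the segment joining them runs along `CH(P)` and
contains no further point of `P`. -/
def Consecutive (P : Finset Plane) (a b : Plane) : Prop :=
  a ≠ b ∧ segment ℝ a b ⊆ CH P ∧ ∀ p ∈ P, p ∈ segment ℝ a b → p = a ∨ p = b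

/-- A chord of `T`: an edge connecting two nonconsecutive points on `CH(P)`. -/
def IsChord (P : Finset Plane) (T : SimpleGraph P) (a b : P) : Prop :=
  T.Adj a b ∧ (a : Plane) ∈ hullPoints P ∧ (b : Plane) ∈ hullPoints P ∧
    ¬ Consecutive P (a : Plane) (b : Plane)

/-- A complex triangle of `T`: a triangle formed by three edges of `T` with a point of `P` in its
interior and another point of `P` in its exterior. -/
def IsComplexTriangle (P : Finset Plane) (T : SimpleGraph P) (a b c : P) : Prop :=
  IsTriangleOf P T a b c ∧
    (∃ p ∈ P, p ∈ interior (triangleRegion a b c)) ∧ (∃ q ∈ P, q ∉ triangleRegion a b c)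

/-- `T` is noncomplex: it has neither chords nor complex triangles. -/
def IsNoncomplex (P : Finset Plane) (T : SimpleGraph P) : Prop :=
  (∀ a b : P, ¬ IsChord P T a b) ∧ (∀ a b c : P, ¬ IsComplexTriangle P T a b c)

/-- `P` admits a noncomplex triangulation. -/
def AdmitsNoncomplexTriangulation (P : Finset Plane) : Prop :=
  ∃ T : SimpleGraph P, IsTriangulation P T ∧ IsNoncomplex P T

end PlanarPointSet

/-! If every point lies on the hull and there are no chords, then all edges run along the hull. The
face around a point of the hull's interior is therefore bounded, so it comes with a triangle of
edges; all three are hull edges, and the hull would be a triangle (`exists_notMem_CH`).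

For the converse a triangulation is encoded by its counterclockwise inner faces (`IsFaceFamily`).
Covering is demanded only at generic points, which avoids boundary cases; closedness and density
recover it everywhere. Noncomplexity is encoded strongly: edges between hull vertices are hull
edges, and every triangle of edges is a face. Such families are built by induction on the number of
points, for sets with an inner point whose hull is not a triangle (`exists_isFaceFamily`). A hull
vertex `a` with hull neighbours `m`, `n` is deleted and restored in one of two ways.

Fan: if the ear `man` contains another point, `a` is joined to the part of the hull of `P \ {a}`
that it sees (`IsFaceFamily.fan`). That chain is longer than the edge `mn`, so no chord arises, and
the hull cannot shrink to a triangle.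

Flip: if the ear is empty, `mn` is a hull edge of `P \ {a}`. Leaving it in place would create a
chord, so it is replaced by the edge from `a` to the third vertex `x` of the face at `mn`
(`IsFaceFamily.flip`). Absence of chords and of a triangular hull makes `x` an inner point.

The flip needs `P \ {a}` to have a non-triangular hull, which fails only for quadrilaterals. There a
single inner point is joined to the four corners (`HullQuad.isFaceFamily_wheel`); with two inner
points, some corner admits a fan and leaves an inner point behind (`HullQuad.exists_inner_erase`).

The topological half identifies the components of the complement of the drawing: the open triangles
of the family and the complement of the hull. -/

namespace PlanarPointSet

/-! ### Orientations and barycentric identities. -/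

/-- Twice the signed area of the triangle `abc`. -/
def orient (a b c : Plane) : ℝ :=
  (b 0 - a 0) * (c 1 - a 1) - (b 1 - a 1) * (c 0 - a 0)

theorem orient_rotate (a b c : Plane) : orient b c a = orient a b c := by
  simp only [orient]; ring

theorem orient_swap (a b c : Plane) : orient b a c = -orient a b c := by
  simp only [orient]; ring

theorem orient_swap_right (a b c : Plane) : orient a c b = -orient a b c := by
  simp only [orient]; ring

@[simp] theorem orient_left (a b : Plane) : orient a b a = 0 := by
  simp only [orient]; ring

@[simp] theorem orient_right (a b : Plane) : orient a b b = 0 := by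
  simp only [orient]; ring

@[simp] theorem orient_self (a b : Plane) : orient a a b = 0 := by
  simp only [orient]; ring

theorem orient_sum (a b c x : Plane) :
    orient b c x + orient c a x + orient a b x = orient a b c := by
  simp only [orient]; ring

/-- The signed areas at `x` are its unnormalised barycentric coordinates in `abc`, and `orient p q`
is affine. -/
theorem orient_barycentric (a b c x p q : Plane) :
    orient b c x * orient p q a + orient c a x * orient p q b + orient a b x * orient p q c
      = orient a b c * orient p q x := by
  simp only [orient]; ring

theorem orient_lineMap (p q x y : Plane) (t : ℝ) :
    orient p q (x + t • (y - x)) = (1 - t) * orient p q x + t * orient p q y := by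
  simp only [orient, PiLp.add_apply, PiLp.smul_apply, PiLp.sub_apply, smul_eq_mul]; ring

theorem ne_of_orient_pos {a b c : Plane} (h : 0 < orient a b c) : a ≠ b ∧ b ≠ c ∧ c ≠ a := by
  refine ⟨?_, ?_, ?_⟩ <;> rintro rfl <;> simp at h

/-- `x` lies strictly inside the counterclockwise triangle `abc`. -/
def Inside (a b c x : Plane) : Prop :=
  0 < orient a b x ∧ 0 < orient b c x ∧ 0 < orient c a x

theorem Inside.rotate {a b c x : Plane} (h : Inside a b c x) : Inside b c a x :=
  ⟨h.2.1, h.2.2, h.1⟩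

theorem Inside.orient_pos {a b c x : Plane} (h : Inside a b c x) : 0 < orient a b c := by
  have := orient_sum a b c x
  obtain ⟨h1, h2, h3⟩ := h
  linarith

theorem Inside.pos {a b c x p q : Plane} (h : Inside a b c x) (ha : 0 ≤ orient p q a)
    (hb : 0 ≤ orient p q b) (hc : 0 ≤ orient p q c)
    (hpos : 0 < orient p q a ∨ 0 < orient p q b ∨ 0 < orient p q c) : 0 < orient p q x := by
  have h0 := h.orient_pos
  obtain ⟨h1, h2, h3⟩ := h
  have := orient_barycentric a b c x p q
  refine (mul_pos_iff_of_pos_left h0).1 ?_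
  rw [← this]
  rcases hpos with h | h | h <;> positivity

/-- No three distinct points of `P` are collinear, in terms of orientations. -/
def OrientGeneral (P : Finset Plane) : Prop :=
  ∀ a ∈ P, ∀ b ∈ P, ∀ c ∈ P, a ≠ b → a ≠ c → b ≠ c → orient a b c ≠ 0

theorem OrientGeneral.erase {P : Finset Plane} (h : OrientGeneral P) (a : Plane) :
    OrientGeneral (P.erase a) := fun x hx y hy z hz =>
  h x (Finset.mem_of_mem_erase hx) y (Finset.mem_of_mem_erase hy) z (Finset.mem_of_mem_erase hz)

/-! ### Edges and vertices of the convex hull. -/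

/-- `ab` is a counterclockwise edge of the convex hull of `P`. -/
def HullEdge (P : Finset Plane) (a b : Plane) : Prop :=
  a ∈ P ∧ b ∈ P ∧ a ≠ b ∧ ∀ p ∈ P, p ≠ a → p ≠ b → 0 < orient a b p

/-- `a` is a vertex of the convex hull of `P`. -/
def HullVertex (P : Finset Plane) (a : Plane) : Prop :=
  ∃ b, HullEdge P a b ∨ HullEdge P b a

namespace HullEdge

variable {P : Finset Plane} {a b c d : Plane}

theorem left_mem (h : HullEdge P a b) : a ∈ P := h.1

theorem right_mem (h : HullEdge P a b) : b ∈ P := h.2.1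

theorem ne (h : HullEdge P a b) : a ≠ b := h.2.2.1

theorem pos (h : HullEdge P a b) {p : Plane} (hp : p ∈ P) (ha : p ≠ a) (hb : p ≠ b) :
    0 < orient a b p := h.2.2.2 p hp ha hb

theorem nonneg (h : HullEdge P a b) {p : Plane} (hp : p ∈ P) : 0 ≤ orient a b p := by
  by_cases ha : p = a
  · simp [ha]
  by_cases hb : p = b
  · simp [hb]
  exact (h.pos hp ha hb).le

theorem eq_or_of_nonpos (h : HullEdge P a b) {p : Plane} (hp : p ∈ P) (h0 : orient a b p ≤ 0) :
    p = a ∨ p = b := by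
  by_contra! hne
  exact absurd (h.pos hp hne.1 hne.2) (not_lt.2 h0)

theorem left (h : HullEdge P a b) : HullVertex P a := ⟨b, Or.inl h⟩

theorem right (h : HullEdge P a b) : HullVertex P b := ⟨a, Or.inr h⟩

theorem right_unique (h : HullEdge P a b) (h' : HullEdge P a c) : b = c := by
  by_contra hne
  have h1 := h.pos h'.right_mem h'.ne.symm (Ne.symm hne)
  have h2 := h'.pos h.right_mem h.ne.symm hne
  rw [orient_swap_right] at h2
  linarith

theorem left_unique (h : HullEdge P a c) (h' : HullEdge P b c) : a = b := by
  by_contra hne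
  have h1 := h.pos h'.left_mem (Ne.symm hne) h'.ne
  have h2 := h'.pos h.left_mem hne h.ne
  simp only [orient] at h1 h2
  linarith

/-- The three corners lie weakly to the left of `ab`. They cannot all lie on the line, because it
carries no points of `P` other than `a` and `b`. -/
theorem inside_pos (h : HullEdge P a b) {p q r x : Plane} (hp : p ∈ P) (hq : q ∈ P) (hr : r ∈ P)
    (hx : Inside p q r x) : 0 < orient a b x := by
  refine hx.pos (h.nonneg hp) (h.nonneg hq) (h.nonneg hr) ?_
  by_contra! hcon
  obtain ⟨h1, h2, h3⟩ := ne_of_orient_pos hx.orient_pos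
  rcases h.eq_or_of_nonpos hp hcon.1 with rfl | rfl <;>
  rcases h.eq_or_of_nonpos hq hcon.2.1 with rfl | rfl <;>
  rcases h.eq_or_of_nonpos hr hcon.2.2 with rfl | rfl <;> simp_all

theorem erase (h : HullEdge P a b) (ha : a ≠ c) (hb : b ≠ c) : HullEdge (P.erase c) a b :=
  ⟨Finset.mem_erase.2 ⟨ha, h.1⟩, Finset.mem_erase.2 ⟨hb, h.2.1⟩, h.ne,
    fun _ hp => h.pos (Finset.mem_of_mem_erase hp)⟩

theorem of_erase (h : HullEdge (P.erase c) a b) (hc : 0 < orient a b c) : HullEdge P a b := by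
  refine ⟨Finset.mem_of_mem_erase h.1, Finset.mem_of_mem_erase h.2.1, h.ne, fun p hp ha hb => ?_⟩
  by_cases hpc : p = c
  · exact hpc ▸ hc
  · exact h.pos (Finset.mem_erase.2 ⟨hpc, hp⟩) ha hb

end HullEdge

namespace HullVertex

variable {P : Finset Plane} {a b c d : Plane}

theorem mem (h : HullVertex P a) : a ∈ P := by
  obtain ⟨b, h | h⟩ := h
  · exact h.left_mem
  · exact h.right_mem

theorem not_inside (h : HullVertex P a) {p q r : Plane} (hp : p ∈ P) (hq : q ∈ P) (hr : r ∈ P) :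
    ¬ Inside p q r a := by
  intro hx
  obtain ⟨b, h | h⟩ := h <;> simpa using h.inside_pos hp hq hr hx

end HullVertex

/-! ### Tangent points and neighbours on the hull. -/

/-- Seen from `a`, a finite set in an open half-plane has a rightmost point. -/
theorem exists_rightmost {a c : Plane} {S : Finset Plane} (hS : S.Nonempty)
    (h : ∀ p ∈ S, 0 < orient a c p) : ∃ b ∈ S, ∀ p ∈ S, 0 ≤ orient a b p := by
  let D : Plane → ℝ := fun p => (c 0 - a 0) * (p 0 - a 0) + (c 1 - a 1) * (p 1 - a 1)
  -- The quotient is the cotangent of the angle at `a` from `c` to `p`, which decreases over the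
  -- half-plane; its maximum is the smallest angle.
  obtain ⟨b, hb, hmax⟩ := S.exists_max_image (fun p => D p / orient a c p) hS
  refine ⟨b, hb, fun p hp => ?_⟩
  have h1 := hmax p hp
  rw [div_le_div_iff₀ (h p hp) (h b hb)] at h1
  have hca : 0 < (c 0 - a 0) ^ 2 + (c 1 - a 1) ^ 2 := by
    by_contra! hcon
    have h0 : c 0 - a 0 = 0 := by nlinarith [sq_nonneg (c 0 - a 0), sq_nonneg (c 1 - a 1)]
    have h0' : c 1 - a 1 = 0 := by nlinarith [sq_nonneg (c 0 - a 0), sq_nonneg (c 1 - a 1)]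
    have := h b hb
    simp [orient, h0, h0'] at this
  refine (mul_nonneg_iff_of_pos_left hca).1 ?_
  simp only [orient, D] at h1 ⊢
  linarith

/-- Seen from `a`, a finite set in an open half-plane has a leftmost point. -/
theorem exists_leftmost {a c : Plane} {S : Finset Plane} (hS : S.Nonempty)
    (h : ∀ p ∈ S, 0 < orient a c p) : ∃ b ∈ S, ∀ p ∈ S, orient a b p ≤ 0 := by
  let D : Plane → ℝ := fun p => (c 0 - a 0) * (p 0 - a 0) + (c 1 - a 1) * (p 1 - a 1)
  obtain ⟨b, hb, hmin⟩ := S.exists_min_image (fun p => D p / orient a c p) hS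
  refine ⟨b, hb, fun p hp => ?_⟩
  have h1 := hmin p hp
  rw [div_le_div_iff₀ (h b hb) (h p hp)] at h1
  have hca : 0 < (c 0 - a 0) ^ 2 + (c 1 - a 1) ^ 2 := by
    by_contra! hcon
    have h0 : c 0 - a 0 = 0 := by nlinarith [sq_nonneg (c 0 - a 0), sq_nonneg (c 1 - a 1)]
    have h0' : c 1 - a 1 = 0 := by nlinarith [sq_nonneg (c 0 - a 0), sq_nonneg (c 1 - a 1)]
    have := h b hb
    simp [orient, h0, h0'] at this
  rw [← neg_nonneg]
  refine (mul_nonneg_iff_of_pos_left hca).1 ?_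
  simp only [orient, D] at h1 ⊢
  linarith

/-- Extending `ab` beyond `b` keeps its supporting line, so the extremal lemmas can be applied at
the head `b` of a hull edge. -/
theorem orient_reflect (a b p : Plane) : orient b (b + (b - a)) p = orient a b p := by
  simp only [orient, PiLp.add_apply, PiLp.sub_apply]; ring

section Neighbours

variable {P : Finset Plane} {a b : Plane}

theorem OrientGeneral.pos_of_nonneg (hP : OrientGeneral P) {x y z : Plane} (hx : x ∈ P)
    (hy : y ∈ P) (hz : z ∈ P) (hxy : x ≠ y) (hxz : x ≠ z) (hyz : y ≠ z)
    (h : 0 ≤ orient x y z) : 0 < orient x y z :=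
  lt_of_le_of_ne h (hP x hx y hy z hz hxy hxz hyz).symm

/-- Deleting the tail `a` of a hull edge `ab` uncovers a hull edge ending in `b`. -/
theorem HullEdge.exists_erase_left (hP : OrientGeneral P) (h : HullEdge P a b)
    (h3 : ∃ p ∈ P, p ≠ a ∧ p ≠ b) : ∃ v, HullEdge (P.erase a) v b ∧ orient v b a < 0 := by
  obtain ⟨p, hp, hpa, hpb⟩ := h3
  obtain ⟨v, hv, hmin⟩ := exists_leftmost (a := b) (c := b + (b - a))
    (S := (P.erase a).erase b) ⟨p, by simp [hp, hpa, hpb]⟩ (fun q hq => by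
      simp only [Finset.mem_erase] at hq
      rw [orient_reflect]
      exact h.pos hq.2.2 hq.2.1 hq.1)
  simp only [Finset.mem_erase] at hv hmin
  refine ⟨v, ⟨by simp [hv], by simp [h.ne.symm, h.right_mem], hv.1, fun q hq hqv hqb => ?_⟩, ?_⟩
  · simp only [Finset.mem_erase] at hq
    refine hP.pos_of_nonneg hv.2.2 h.right_mem hq.2 hv.1 hqv.symm hqb.symm ?_
    have := hmin q ⟨hqb, hq⟩
    rw [orient_swap]
    linarith
  · have := h.pos hv.2.2 hv.2.1 hv.1
    simp only [orient] at this ⊢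
    linarith

/-- Deleting the head `b` of a hull edge `ab` uncovers a hull edge starting in `a`. -/
theorem HullEdge.exists_erase_right (hP : OrientGeneral P) (h : HullEdge P a b)
    (h3 : ∃ p ∈ P, p ≠ a ∧ p ≠ b) : ∃ v, HullEdge (P.erase b) a v ∧ orient a v b < 0 := by
  obtain ⟨p, hp, hpa, hpb⟩ := h3
  obtain ⟨v, hv, hmin⟩ := exists_rightmost (a := a) (c := b)
    (S := (P.erase a).erase b) ⟨p, by simp [hp, hpa, hpb]⟩ (fun q hq => by
      simp only [Finset.mem_erase] at hq
      exact h.pos hq.2.2 hq.2.1 hq.1)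
  simp only [Finset.mem_erase] at hv hmin
  refine ⟨v, ⟨by simp [h.ne, h.left_mem], by simp [hv], hv.2.1.symm, fun q hq hqa hqv => ?_⟩, ?_⟩
  · simp only [Finset.mem_erase] at hq
    exact hP.pos_of_nonneg h.left_mem hv.2.2 hq.2 hv.2.1.symm hqa.symm hqv.symm
      (hmin q ⟨hq.1, hqa, hq.2⟩)
  · have := h.pos hv.2.2 hv.2.1 hv.1
    simp only [orient] at this ⊢
    linarith

/-- Gift wrapping: the next vertex is the rightmost point seen from `b`; only the excluded point `a`
has to be checked separately. -/
theorem HullEdge.exists_next (hP : OrientGeneral P) (h : HullEdge P a b)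
    (h3 : ∃ p ∈ P, p ≠ a ∧ p ≠ b) : ∃ c, HullEdge P b c := by
  obtain ⟨p, hp, hpa, hpb⟩ := h3
  obtain ⟨v, hv, hmin⟩ := exists_rightmost (a := b) (c := b + (b - a))
    (S := (P.erase a).erase b) ⟨p, by simp [hp, hpa, hpb]⟩ (fun q hq => by
      simp only [Finset.mem_erase] at hq
      rw [orient_reflect]
      exact h.pos hq.2.2 hq.2.1 hq.1)
  simp only [Finset.mem_erase] at hv hmin
  refine ⟨v, h.right_mem, hv.2.2, hv.1.symm, fun q hq hqb hqv => ?_⟩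
  by_cases hqa : q = a
  · subst hqa
    rw [orient_rotate]
    exact h.pos hv.2.2 hv.2.1 hv.1
  · exact hP.pos_of_nonneg h.right_mem hv.2.2 hq hv.1.symm hqb.symm hqv.symm
      (hmin q ⟨hqb, hqa, hq⟩)

theorem HullEdge.exists_prev (hP : OrientGeneral P) (h : HullEdge P a b)
    (h3 : ∃ p ∈ P, p ≠ a ∧ p ≠ b) : ∃ c, HullEdge P c a := by
  obtain ⟨p, hp, hpa, hpb⟩ := h3
  obtain ⟨v, hv, hmin⟩ := exists_leftmost (a := a) (c := b)
    (S := (P.erase a).erase b) ⟨p, by simp [hp, hpa, hpb]⟩ (fun q hq => by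
      simp only [Finset.mem_erase] at hq
      exact h.pos hq.2.2 hq.2.1 hq.1)
  simp only [Finset.mem_erase] at hv hmin
  refine ⟨v, hv.2.2, h.left_mem, hv.2.1, fun q hq hqv hqa => ?_⟩
  by_cases hqb : q = b
  · subst hqb
    rw [← orient_rotate]
    exact h.pos hv.2.2 hv.2.1 hv.1
  · refine hP.pos_of_nonneg hv.2.2 h.left_mem hq hv.2.1 hqv.symm hqa.symm ?_
    have := hmin q ⟨hqb, hqa, hq⟩
    rw [orient_swap]
    linarith

end Neighbours

/-! ### Face families. -/

/-- `x` lies on no line through two points of `P`. -/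
def Generic (P : Finset Plane) (x : Plane) : Prop :=
  ∀ p ∈ P, ∀ q ∈ P, p ≠ q → orient p q x ≠ 0

theorem Generic.erase {P : Finset Plane} {x : Plane} (h : Generic P x) (a : Plane) :
    Generic (P.erase a) x := fun p hp q hq =>
  h p (Finset.mem_of_mem_erase hp) q (Finset.mem_of_mem_erase hq)

/-- The convex hull of `P` is not a triangle. -/
def HullNotTriangle (P : Finset Plane) : Prop :=
  ∀ a b c, HullEdge P a b → HullEdge P b c → ¬ HullEdge P c a

/-- `p` and `q` span a side of a face in the family `F` of counterclockwise triangles. -/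
def Edge (F : Plane → Plane → Plane → Prop) (p q : Plane) : Prop :=
  ∃ r, F p q r ∨ F q p r

theorem Edge.symm {F : Plane → Plane → Plane → Prop} {p q : Plane} (h : Edge F p q) :
    Edge F q p := by
  obtain ⟨r, h⟩ := h
  exact ⟨r, h.symm⟩

/-- Two triples are equal up to rotation. -/
def SameTriangle (a b c a' b' c' : Plane) : Prop :=
  (a' = a ∧ b' = b ∧ c' = c) ∨ (a' = b ∧ b' = c ∧ c' = a) ∨ (a' = c ∧ b' = a ∧ c' = b)

/-- `F` is the family of counterclockwise inner faces of a noncomplex triangulation of `P`. -/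
structure IsFaceFamily (P : Finset Plane) (F : Plane → Plane → Plane → Prop) : Prop where
  rotate : ∀ {a b c}, F a b c → F b c a
  mem : ∀ {a b c}, F a b c → a ∈ P
  orient_pos : ∀ {a b c}, F a b c → 0 < orient a b c
  empty : ∀ {a b c}, F a b c → ∀ p ∈ P, ¬ Inside a b c p
  cover : ∀ x, Generic P x → (∀ a b, HullEdge P a b → 0 < orient a b x) →
    ∃ a b c, F a b c ∧ Inside a b c x
  disjoint : ∀ {a b c a' b' c' x}, F a b c → F a' b' c' → Inside a b c x → Inside a' b' c' x →
    SameTriangle a b c a' b' c'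
  hull : ∀ {a b}, HullEdge P a b → ∃ c, F a b c
  chord : ∀ {a b}, Edge F a b → HullVertex P a → HullVertex P b → HullEdge P a b ∨ HullEdge P b a
  triangle : ∀ {a b c}, Edge F a b → Edge F b c → Edge F c a → 0 < orient a b c → F a b c

/-- Rotations of a family of triples. -/
def Rotations (G : Plane → Plane → Plane → Prop) (x y z : Plane) : Prop :=
  G x y z ∨ G y z x ∨ G z x y

theorem Rotations.rotate {G : Plane → Plane → Plane → Prop} {x y z : Plane}
    (h : Rotations G x y z) : Rotations G y z x := by
  unfold Rotations at *; tauto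

theorem IsFaceFamily.mem_left {P F} (h : IsFaceFamily P F) {a b : Plane} (hab : Edge F a b) :
    a ∈ P := by
  obtain ⟨c, hc | hc⟩ := hab
  · exact h.mem hc
  · exact h.mem (h.rotate hc)

theorem IsFaceFamily.mem_right {P F} (h : IsFaceFamily P F) {a b : Plane} (hab : Edge F a b) :
    b ∈ P := h.mem_left hab.symm

theorem IsFaceFamily.ne {P F} (h : IsFaceFamily P F) {a b : Plane} (hab : Edge F a b) :
    a ≠ b := by
  obtain ⟨c, hc | hc⟩ := hab
  · exact (ne_of_orient_pos (h.orient_pos hc)).1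
  · exact (ne_of_orient_pos (h.orient_pos hc)).1.symm

theorem exists_third {P : Finset Plane} (h : 2 < P.card) (a b : Plane) :
    ∃ p ∈ P, p ≠ a ∧ p ≠ b := by
  by_contra! hcon
  have : P ⊆ {a, b} := fun p hp => by
    by_cases hpa : p = a
    · simp [hpa]
    · simp [hcon p hp hpa]
  exact absurd ((Finset.card_le_card this).trans Finset.card_le_two) (not_le.2 h)

section

variable {P : Finset Plane} {a b m n p q : Plane}

theorem HullVertex.exists_next (hP : OrientGeneral P) (h3 : 2 < P.card) (h : HullVertex P a) :
    ∃ b, HullEdge P a b := by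
  obtain ⟨b, h | h⟩ := h
  · exact ⟨b, h⟩
  · exact h.exists_next hP (exists_third h3 _ _)

theorem HullVertex.exists_prev (hP : OrientGeneral P) (h3 : 2 < P.card) (h : HullVertex P a) :
    ∃ b, HullEdge P b a := by
  obtain ⟨b, h | h⟩ := h
  · exact h.exists_prev hP (exists_third h3 _ _)
  · exact ⟨b, h⟩

theorem HullVertex.erase (hP : OrientGeneral P) (h3 : 2 < P.card) (h : HullVertex P p)
    (hpa : p ≠ a) : HullVertex (P.erase a) p := by
  obtain ⟨w, hw⟩ := h.exists_next hP h3
  by_cases hwa : w = a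
  · subst hwa
    obtain ⟨v, hv, -⟩ := hw.exists_erase_right hP (exists_third h3 _ _)
    exact hv.left
  · exact (hw.erase hpa hwa).left

/-! ### Restoring a hull vertex by a fan. -/

/-- A hull edge of `P \ {a}` that is visible from `a`. -/
def VisibleEdge (P : Finset Plane) (a p q : Plane) : Prop :=
  HullEdge (P.erase a) p q ∧ orient p q a < 0

/-- If the hull predecessor of `q` were not `a`, it would survive the deletion and equal `p`; but
`a` lies on the wrong side of `pq`. -/
theorem VisibleEdge.right_edge (hP : OrientGeneral P) (h3 : 2 < P.card) (h : VisibleEdge P a p q)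
    (ha : a ∈ P) (hq : HullVertex P q) : HullEdge P a q := by
  have hqa : q ≠ a := Finset.ne_of_mem_erase h.1.right_mem
  have hpa : p ≠ a := Finset.ne_of_mem_erase h.1.left_mem
  obtain ⟨w, hw⟩ := hq.exists_prev hP h3
  by_cases hwa : w = a
  · exact hwa ▸ hw
  · have := (hw.erase hwa hqa).left_unique h.1
    subst this
    exact absurd (hw.pos ha hpa.symm hqa.symm) (not_lt.2 h.2.le)

theorem VisibleEdge.left_edge (hP : OrientGeneral P) (h3 : 2 < P.card) (h : VisibleEdge P a p q)
    (ha : a ∈ P) (hp : HullVertex P p) : HullEdge P p a := by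
  have hqa : q ≠ a := Finset.ne_of_mem_erase h.1.right_mem
  have hpa : p ≠ a := Finset.ne_of_mem_erase h.1.left_mem
  obtain ⟨w, hw⟩ := hp.exists_next hP h3
  by_cases hwa : w = a
  · exact hwa ▸ hw
  · have := (hw.erase hpa hwa).right_unique h.1
    subst this
    exact absurd (hw.pos ha hpa.symm hqa.symm) (not_lt.2 h.2.le)

theorem HullEdge.visible_or (hP : OrientGeneral P) (ha : a ∈ P)
    (h : HullEdge (P.erase a) p q) : HullEdge P p q ∨ VisibleEdge P a p q := by
  have hqa := Finset.mem_erase.1 h.right_mem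
  have hpa := Finset.mem_erase.1 h.left_mem
  rcases lt_or_gt_of_ne (hP p hpa.2 q hqa.2 a ha h.ne hpa.1 hqa.1) with h0 | h0
  · exact Or.inr ⟨h, h0⟩
  · exact Or.inl (h.of_erase h0)

/-- This is the affine dependence of the four points `a`, `u`, `v`, `x`, with signed areas as
coefficients, evaluated at the affine function `orient p q`. -/
theorem orient_dependency (u v x a p q : Plane) :
    orient v u x * orient p q a = orient a x v * orient p q u + orient a u x * orient p q v
      - orient u v a * orient p q x := by
  simp only [orient]; ring

/-- Among the points on either side of the ray from `a` through `x`, the pair whose joining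
segment crosses the ray first spans a hull edge. -/
theorem exists_first_crossing {x : Plane} {Q : Finset Plane} (hQ : OrientGeneral Q)
    (hx : ∀ p ∈ Q, orient a x p ≠ 0) (hr : ∃ p ∈ Q, orient a x p < 0)
    (hl : ∃ p ∈ Q, 0 < orient a x p) :
    ∃ v u, HullEdge Q v u ∧ orient a x u < 0 ∧ 0 < orient a x v := by
  let f : Plane → ℝ := orient a x
  let g : Plane → ℝ := fun p => (x 0 - a 0) * (p 0 - a 0) + (x 1 - a 1) * (p 1 - a 1)
  have hD : 0 < (x 0 - a 0) ^ 2 + (x 1 - a 1) ^ 2 := by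
    by_contra! hcon
    obtain ⟨p, hp, hp0⟩ := hl
    have h0 : x 0 - a 0 = 0 := by nlinarith [sq_nonneg (x 0 - a 0), sq_nonneg (x 1 - a 1)]
    have h0' : x 1 - a 1 = 0 := by nlinarith [sq_nonneg (x 0 - a 0), sq_nonneg (x 1 - a 1)]
    simp [orient, h0, h0'] at hp0
  have key : ∀ p q r, ((x 0 - a 0) ^ 2 + (x 1 - a 1) ^ 2) * orient p q r
      = (g q - g p) * (f r - f p) - (f q - f p) * (g r - g p) := by
    intro p q r
    simp only [f, g, orient]; ring
  obtain ⟨u₀, hu₀, hu₀'⟩ := hr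
  obtain ⟨v₀, hv₀, hv₀'⟩ := hl
  -- In the coordinates `g` along `ax` and `f` across it, the quotient is the `g`-coordinate of the
  -- point where segment `uv` meets the line `ax`. Minimality against pairs with `u` or `v` replaced
  -- by `p` puts `p` to the left of `vu`.
  obtain ⟨⟨u, v⟩, huv, hmin⟩ := Finset.exists_min_image
    ((Q.filter fun p => f p < 0) ×ˢ (Q.filter fun p => 0 < f p))
    (fun w => (g w.1 * f w.2 - g w.2 * f w.1) / (f w.2 - f w.1))
    ⟨(u₀, v₀), by simp [f, hu₀, hv₀, hu₀', hv₀']⟩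
  simp only [Finset.mem_product, Finset.mem_filter, Prod.forall] at huv hmin
  obtain ⟨⟨hu, hfu⟩, hv, hfv⟩ := huv
  have huv : v ≠ u := by rintro rfl; linarith
  refine ⟨v, u, ⟨hv, hu, huv, fun p hp hpv hpu => ?_⟩, hfu, hfv⟩
  refine hQ.pos_of_nonneg hv hu hp huv hpv.symm hpu.symm ?_
  refine (mul_nonneg_iff_of_pos_left hD).1 ?_
  rw [key]
  rcases lt_or_gt_of_ne (hx p hp) with h0 | h0
  · have h0 : f p < 0 := h0
    have := hmin p v ⟨⟨hp, h0⟩, hv, hfv⟩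
    rw [div_le_div_iff₀ (by linarith) (by linarith)] at this
    refine (mul_nonneg_iff_of_pos_left hfv).1 ?_
    linarith
  · have h0 : 0 < f p := h0
    have := hmin u p ⟨⟨hu, hfu⟩, hp, h0⟩
    rw [div_le_div_iff₀ (by linarith) (by linarith)] at this
    refine (mul_nonneg_iff_of_pos_left (neg_pos.2 hfu)).1 ?_
    linarith

/-- The faces of `P \ {a}` together with the triangles joining `a` to the visible hull edges. -/
def fan (P : Finset Plane) (a : Plane) (F : Plane → Plane → Plane → Prop) (x y z : Plane) : Prop :=
  F x y z ∨ Rotations (fun x y z => VisibleEdge P a y x ∧ z = a) x y z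

/-- The left side of the identity in `key` compares where the ray from `a` through `x` meets the
lines `pq` and `p'q'`. It is nonnegative and changes sign when the two edges are exchanged, so it
vanishes, and `p'`, `q'` lie on the line `pq`. -/
theorem VisibleEdge.inside_unique {p' q' x : Plane}
    (h : VisibleEdge P a p q) (h' : VisibleEdge P a p' q')
    (hx : Inside q p a x) (hx' : Inside q' p' a x) : p' = p ∧ q' = q := by
  have key : ∀ {p q p' q'}, VisibleEdge P a p q → VisibleEdge P a p' q' →
      Inside q p a x → Inside q' p' a x →
      orient p q x * orient p' q' a - orient p q a * orient p' q' x
        = orient a x p * orient p' q' q + orient a q x * orient p' q' p ∧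
      0 < orient a x p ∧ 0 < orient a q x ∧ 0 ≤ orient p' q' p ∧ 0 ≤ orient p' q' q := by
    intro p q p' q' h h' hx hx'
    have h1 := orient_dependency q p x a p' q'
    have h2 : orient q p a = - orient p q a := orient_swap _ _ _
    refine ⟨by rw [h2] at h1; linarith, ?_, hx.2.2, h'.1.nonneg h.1.left_mem,
      h'.1.nonneg h.1.right_mem⟩
    rw [orient_rotate p a x]
    exact hx.2.1
  obtain ⟨e1, p1, p2, p3, p4⟩ := key h h' hx hx'
  obtain ⟨e2, q1, q2, q3, q4⟩ := key h' h hx' hx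
  have r1 := mul_nonneg p1.le p4
  have r2 := mul_nonneg p2.le p3
  have r3 := mul_nonneg q1.le q4
  have r4 := mul_nonneg q2.le q3
  have s1 : orient p q p' = 0 := by
    have : orient a q' x * orient p q p' = 0 := by linarith
    exact (mul_eq_zero.1 this).resolve_left q2.ne'
  have s2 : orient p q q' = 0 := by
    have : orient a x p' * orient p q q' = 0 := by linarith
    exact (mul_eq_zero.1 this).resolve_left q1.ne'
  rcases h.1.eq_or_of_nonpos h'.1.left_mem s1.le with rfl | rfl <;>
  rcases h.1.eq_or_of_nonpos h'.1.right_mem s2.le with rfl | rfl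
  · exact absurd rfl h'.1.ne
  · exact ⟨rfl, rfl⟩
  · have := h.2
    have := h'.2
    rw [orient_swap] at this
    linarith
  · exact absurd rfl h'.1.ne

/-- Triangulating a hull vertex `a` whose removal uncovers a further point by a fan. -/
theorem IsFaceFamily.fan {F : Plane → Plane → Plane → Prop} (hP : OrientGeneral P)
    (h3 : 2 < P.card) (hT : HullNotTriangle P) (hma : HullEdge P m a) (han : HullEdge P a n)
    {w : Plane} (hw : w ∈ P) (hwa : w ≠ a) (hmn : orient m n w < 0)
    (hF : IsFaceFamily (P.erase a) F) : IsFaceFamily P (fan P a F) := by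
  have ha := hma.right_mem
  have hedge : ∀ {p q}, Edge (PlanarPointSet.fan P a F) p q → Edge F p q ∨
      (q = a ∧ ∃ r, VisibleEdge P a p r ∨ VisibleEdge P a r p) ∨
      (p = a ∧ ∃ r, VisibleEdge P a q r ∨ VisibleEdge P a r q) := by
    have hvis : ∀ {p q}, VisibleEdge P a p q → Edge F p q := fun h => by
      obtain ⟨c, hc⟩ := hF.hull h.1
      exact ⟨c, Or.inl hc⟩
    rintro p q ⟨r, (h | ⟨h, e⟩ | ⟨h, e⟩ | ⟨h, e⟩) | (h | ⟨h, e⟩ | ⟨h, e⟩ | ⟨h, e⟩)⟩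
    · exact Or.inl ⟨r, Or.inl h⟩
    · exact Or.inl (hvis h).symm
    · exact Or.inr (Or.inr ⟨e, r, Or.inr h⟩)
    · exact Or.inr (Or.inl ⟨e, r, Or.inl h⟩)
    · exact Or.inl ⟨r, Or.inr h⟩
    · exact Or.inl (hvis h)
    · exact Or.inr (Or.inl ⟨e, r, Or.inr h⟩)
    · exact Or.inr (Or.inr ⟨e, r, Or.inl h⟩)
  have hrot : ∀ {x y z}, PlanarPointSet.fan P a F x y z → PlanarPointSet.fan P a F y z x := by
    rintro x y z (h | h)
    · exact Or.inl (hF.rotate h)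
    · exact Or.inr h.rotate
  have hne : ∀ {p q}, Edge F p q → p ≠ a ∧ q ≠ a := fun h =>
    ⟨Finset.ne_of_mem_erase (hF.mem_left h), Finset.ne_of_mem_erase (hF.mem_right h)⟩
  have hvisold : ∀ {p q x y z s}, VisibleEdge P a p q → Inside q p a s → F x y z →
      ¬ Inside x y z s := by
    intro p q x y z s hv hs hf hs'
    have := hv.1.inside_pos (hF.mem hf) (hF.mem (hF.rotate hf)) (hF.mem (hF.rotate (hF.rotate hf)))
      hs'
    have h2 := hs.1
    rw [orient_swap] at h2
    linarith
  have hend : ∀ {p}, (∃ r, VisibleEdge P a p r ∨ VisibleEdge P a r p) → HullVertex P p →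
      HullEdge P a p ∨ HullEdge P p a := by
    rintro p ⟨r, h | h⟩ hp
    · exact Or.inr (h.left_edge hP h3 ha hp)
    · exact Or.inl (h.right_edge hP h3 ha hp)
  refine ⟨hrot, ?_, ?_, ?_, ?_, ?_, ?_, ?_, ?_⟩
  · rintro x y z (h | ⟨h, rfl⟩ | ⟨h, rfl⟩ | ⟨h, rfl⟩)
    · exact Finset.mem_of_mem_erase (hF.mem h)
    · exact Finset.mem_of_mem_erase h.1.right_mem
    · exact ha
    · exact Finset.mem_of_mem_erase h.1.left_mem
  · rintro x y z (h | ⟨h, rfl⟩ | ⟨h, rfl⟩ | ⟨h, rfl⟩)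
    · exact hF.orient_pos h
    all_goals
      have := h.2
      simp only [orient] at this ⊢
      linarith
  · have key : ∀ {x y}, VisibleEdge P a y x → ∀ p ∈ P, ¬ Inside x y a p := by
      intro x y h p hp hin
      by_cases hpa : p = a
      · subst hpa
        simpa using hin.2.1
      · have h1 := h.1.nonneg (Finset.mem_erase.2 ⟨hpa, hp⟩)
        have h2 := hin.1
        rw [orient_swap] at h2
        linarith
    rintro x y z (h | ⟨h, rfl⟩ | ⟨h, rfl⟩ | ⟨h, rfl⟩) p hp hin
    · by_cases hpa : p = a
      · subst hpa
        exact hma.right.not_inside (Finset.mem_of_mem_erase (hF.mem h))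
          (Finset.mem_of_mem_erase (hF.mem (hF.rotate h)))
          (Finset.mem_of_mem_erase (hF.mem (hF.rotate (hF.rotate h)))) hin
      · exact hF.empty h p (Finset.mem_erase.2 ⟨hpa, hp⟩) hin
    · exact key h p hp hin
    · exact key h p hp hin.rotate
    · exact key h p hp hin.rotate.rotate
  · intro x hx hin
    by_cases hall : ∀ p q, HullEdge (P.erase a) p q → 0 < orient p q x
    · obtain ⟨p, q, r, hf, hi⟩ := hF.cover x (hx.erase a) hall
      exact ⟨p, q, r, Or.inl hf, hi⟩
    push Not at hall
    obtain ⟨p, q, hpq, hneg⟩ := hall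
    replace hneg := lt_of_le_of_ne hneg (hx p (Finset.mem_of_mem_erase hpq.1) q
      (Finset.mem_of_mem_erase hpq.2.1) hpq.ne)
    -- Now `x` lies outside the hull of `P \ {a}`. The fan triangle containing it stands on the hull
    -- edge that the ray from `a` through `x` crosses first; `m` and `n` lie on the two sides of
    -- this ray.
    obtain ⟨v, u, hvu, hu, hv⟩ := exists_first_crossing (a := a) (x := x) (hP.erase a)
      (fun p hp h0 => by
        rw [orient_swap_right, neg_eq_zero] at h0
        exact hx a ha p (Finset.mem_of_mem_erase hp) (Finset.ne_of_mem_erase hp).symm h0)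
      ⟨n, Finset.mem_erase.2 ⟨han.ne.symm, han.right_mem⟩, by
        have := hin a n han
        rw [orient_swap_right]
        linarith⟩
      ⟨m, Finset.mem_erase.2 ⟨hma.ne, hma.left_mem⟩, by
        rw [orient_rotate m a x]
        exact hin m a hma⟩
    have hu' : 0 < orient a u x := by
      rw [orient_swap_right]
      linarith
    -- The point `x` comes before the crossing. Otherwise the edge `pq`, which has `x` on its outer
    -- side, would have `a` weakly on its inner side; it would be a hull edge of `P`, with `x` to
    -- its left.
    have hvx : orient v u x < 0 := by
      by_contra! hvx
      have hvx := lt_of_le_of_ne hvx (hx v (Finset.mem_of_mem_erase hvu.1) u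
        (Finset.mem_of_mem_erase hvu.2.1) hvu.ne).symm
      have h1 : 0 ≤ orient u v a := by
        by_contra! h1
        have e := orient_dependency u v x a a n
        have e1 := mul_nonneg hv.le (han.nonneg (Finset.mem_of_mem_erase hvu.2.1))
        have e2 := mul_nonneg hu'.le (han.nonneg (Finset.mem_of_mem_erase hvu.1))
        have e3 := mul_neg_of_neg_of_pos h1 (hin a n han)
        rw [orient_left, mul_zero] at e
        linarith
      have e := orient_dependency u v x a p q
      have e1 := mul_nonneg hv.le (hpq.nonneg hvu.2.1)
      have e2 := mul_nonneg hu'.le (hpq.nonneg hvu.1)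
      have e3 := mul_nonpos_of_nonneg_of_nonpos h1 hneg.le
      have e4 : 0 ≤ orient p q a := by
        refine (mul_nonneg_iff_of_pos_left hvx).1 ?_
        linarith
      rcases hpq.visible_or hP ha with h | h
      · linarith [hin p q h]
      · linarith [h.2]
    have hin' : Inside u v a x := by
      refine ⟨by rw [orient_swap]; linarith, ?_, hu'⟩
      rw [← orient_rotate v a x]
      exact hv
    refine ⟨u, v, a, Or.inr (Or.inl ⟨⟨hvu, ?_⟩, rfl⟩), hin'⟩
    have := hin'.orient_pos
    rw [orient_swap]
    linarith
  · have key : ∀ {x y z x' y' z' s}, PlanarPointSet.fan P a F x' y' z' → Inside x' y' z' s →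
        VisibleEdge P a y x → z = a → Inside x y z s → SameTriangle x y z x' y' z' := by
      rintro x y z x' y' z' s h' hs' h rfl hs
      rcases h' with h' | ⟨h', rfl⟩ | ⟨h', rfl⟩ | ⟨h', rfl⟩
      · exact absurd hs' (hvisold h hs h')
      · obtain ⟨rfl, rfl⟩ := h.inside_unique h' hs hs'
        exact Or.inl ⟨rfl, rfl, rfl⟩
      · obtain ⟨rfl, rfl⟩ := h.inside_unique h' hs hs'.rotate
        exact Or.inr (Or.inr ⟨rfl, rfl, rfl⟩)
      · obtain ⟨rfl, rfl⟩ := h.inside_unique h' hs hs'.rotate.rotate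
        exact Or.inr (Or.inl ⟨rfl, rfl, rfl⟩)
    intro x y z x' y' z' s h h' hs hs'
    rcases h with h | ⟨h, e⟩ | ⟨h, e⟩ | ⟨h, e⟩
    · rcases h' with h' | ⟨h', rfl⟩ | ⟨h', rfl⟩ | ⟨h', rfl⟩
      · exact hF.disjoint h h' hs hs'
      · exact absurd hs (hvisold h' hs' h)
      · exact absurd hs (hvisold h' hs'.rotate h)
      · exact absurd hs (hvisold h' hs'.rotate.rotate h)
    · exact key h' hs' h e hs
    · have := key h' hs' h e hs.rotate
      unfold SameTriangle at *; tauto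
    · have := key h' hs' h e hs.rotate.rotate
      unfold SameTriangle at *; tauto
  · intro p q h
    by_cases hpa : p = a
    · subst hpa
      obtain ⟨v, hv⟩ := h.exists_erase_left hP (exists_third h3 _ _)
      exact ⟨v, Or.inr (Or.inr (Or.inl ⟨hv, rfl⟩))⟩
    by_cases hqa : q = a
    · subst hqa
      obtain ⟨v, hv⟩ := h.exists_erase_right hP (exists_third h3 _ _)
      exact ⟨v, Or.inr (Or.inr (Or.inr ⟨hv, rfl⟩))⟩
    obtain ⟨c, hc⟩ := hF.hull (h.erase hpa hqa)
    exact ⟨c, Or.inl hc⟩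
  -- A visible edge between two hull vertices of `P` must be `mn`, but then `w` lies outside it.
  · have key : ∀ {p q}, HullEdge (P.erase a) p q → HullVertex P p → HullVertex P q →
        HullEdge P p q := by
      intro p q h hp hq
      rcases h.visible_or hP ha with h' | h'
      · exact h'
      · have e1 := (h'.left_edge hP h3 ha hp).left_unique hma
        have e2 := (h'.right_edge hP h3 ha hq).right_unique han
        subst e1 e2
        exact absurd (h.nonneg (Finset.mem_erase.2 ⟨hwa, hw⟩)) (not_le.2 hmn)
    intro p q h hp hq
    rcases hedge h with h | ⟨rfl, h⟩ | ⟨rfl, h⟩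
    · rcases hF.chord h (hp.erase hP h3 (hne h).1) (hq.erase hP h3 (hne h).2) with h | h
      · exact Or.inl (key h hp hq)
      · exact Or.inr (key h hq hp)
    · exact (hend h hp).symm
    · exact hend h hq
  -- The absence of chords makes `qr` a hull edge of `P \ {a}`. With `a` on its inner side it would
  -- be a hull edge of `P`, and `aqr` would be a triangular hull; hence it is visible and `aqr` is a
  -- fan face.
  · have key : ∀ {q r}, Edge F q r → (∃ s, VisibleEdge P a q s ∨ VisibleEdge P a s q) →
        (∃ s, VisibleEdge P a r s ∨ VisibleEdge P a s r) → 0 < orient a q r →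
        VisibleEdge P a r q := by
      intro q r he hq hr h0
      have hq' : HullVertex (P.erase a) q := by
        obtain ⟨s, h | h⟩ := hq
        exacts [h.1.left, h.1.right]
      have hr' : HullVertex (P.erase a) r := by
        obtain ⟨s, h | h⟩ := hr
        exacts [h.1.left, h.1.right]
      rcases hF.chord he hq' hr' with h | h
      · have h1 : 0 < orient q r a := by rwa [orient_rotate]
        have h2 := h.of_erase h1
        have e1 : HullEdge P a q := by
          obtain ⟨s, hs | hs⟩ := hq
          · have := hs.1.right_unique h
            subst this
            linarith [hs.2]
          · exact hs.right_edge hP h3 ha h2.left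
        have e2 : HullEdge P r a := by
          obtain ⟨s, hs | hs⟩ := hr
          · exact hs.left_edge hP h3 ha h2.right
          · have := hs.1.left_unique h
            subst this
            linarith [hs.2]
        exact absurd e2 (hT _ _ _ e1 h2)
      · refine ⟨h, ?_⟩
        simp only [orient] at h0 ⊢
        linarith
    intro p q r h1 h2 h3 h0
    rcases hedge h1 with e1 | ⟨rfl, e1⟩ | ⟨rfl, e1⟩
    · rcases hedge h2 with e2 | ⟨rfl, e2⟩ | ⟨rfl, e2⟩
      · rcases hedge h3 with e3 | ⟨rfl, e3⟩ | ⟨rfl, e3⟩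
        · exact Or.inl (hF.triangle e1 e2 e3 h0)
        · exact absurd rfl (hne e1).1
        · exact absurd rfl (hne e2).2
      · rcases hedge h3 with e3 | ⟨rfl, e3⟩ | ⟨-, e3⟩
        · exact absurd rfl (hne e3).1
        · exact absurd rfl (hne e1).1
        · exact Or.inr (Or.inl ⟨key e1 e3 e2 (by rwa [← orient_rotate]), rfl⟩)
      · exact absurd rfl (hne e1).2
    · have hpa : p ≠ q := (ne_of_orient_pos h0).1
      have hra : r ≠ q := (ne_of_orient_pos h0).2.1.symm
      rcases hedge h2 with e2 | ⟨rfl, e2⟩ | ⟨-, e2⟩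
      · exact absurd rfl (hne e2).1
      · exact absurd rfl hra
      rcases hedge h3 with e3 | ⟨rfl, e3⟩ | ⟨rfl, e3⟩
      · refine Or.inr (Or.inr (Or.inr ⟨key e3 e2 e1 (by rwa [orient_rotate]), rfl⟩))
      · exact absurd rfl hpa
      · exact absurd rfl hra
    · have hqa : q ≠ p := (ne_of_orient_pos h0).1.symm
      have hra : r ≠ p := (ne_of_orient_pos h0).2.2
      rcases hedge h3 with e3 | ⟨-, e3⟩ | ⟨rfl, e3⟩
      · exact absurd rfl (hne e3).2
      · rcases hedge h2 with e2 | ⟨rfl, e2⟩ | ⟨rfl, e2⟩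
        · exact Or.inr (Or.inr (Or.inl ⟨key e2 e1 e3 h0, rfl⟩))
        · exact absurd rfl hra
        · exact absurd rfl hqa
      · exact absurd rfl hra

end

end PlanarPointSet

open Filter Topology in
theorem eventually_pos_of_pos {A : ℝ} (hA : 0 < A) (B : ℝ) :
    ∀ᶠ t in 𝓝[>] (0 : ℝ), 0 < (1 - t) * A + t * B := by
  have hc : Continuous fun t : ℝ => (1 - t) * A + t * B := by fun_prop
  have := hc.tendsto 0
  simp only [sub_zero, one_mul, zero_mul, add_zero] at this
  exact (this.eventually (lt_mem_nhds hA)).filter_mono nhdsWithin_le_nhds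

/-! ### Overlapping faces and restoring a hull vertex by a flip. -/

namespace PlanarPointSet

section

variable {P : Finset Plane} {F : Plane → Plane → Plane → Prop} {a b c d m n x y p q r : Plane}

theorem SameTriangle.of_rotate (h : SameTriangle a b c q r p) : SameTriangle a b c p q r := by
  rcases h with ⟨h1, h2, h3⟩ | ⟨h1, h2, h3⟩ | ⟨h1, h2, h3⟩
  exacts [Or.inr (Or.inr ⟨h3, h1, h2⟩), Or.inl ⟨h3, h1, h2⟩, Or.inr (Or.inl ⟨h3, h1, h2⟩)]

theorem SameTriangle.trans_left {u v w p' q' r' : Plane} (h : SameTriangle u v w p q r)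
    (h' : SameTriangle u v w p' q' r') : SameTriangle p q r p' q' r' := by
  rcases h with ⟨rfl, rfl, rfl⟩ | ⟨rfl, rfl, rfl⟩ | ⟨rfl, rfl, rfl⟩
  · exact h'
  · exact h'.elim (fun h => Or.inr (Or.inr h)) (Or.elim · Or.inl fun h => Or.inr (Or.inl h))
  · exact h'.elim (fun h => Or.inr (Or.inl h)) (Or.elim · (fun h => Or.inr (Or.inr h)) Or.inl)

/-- Two triangles on the same side of a common side overlap. -/
theorem exists_common_inside (hc : 0 < orient a b c) (hd : 0 < orient a b d) :
    ∃ x, Inside a b c x ∧ Inside a b d x := by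
  -- A point slightly above the midpoint of `ab`, in the direction of `c`, lies in both triangles.
  let e : Plane := a + (1 / 2 : ℝ) • (b - a)
  have he : ∀ p q, orient p q e = (1 - 1 / 2) * orient p q a + 1 / 2 * orient p q b :=
    fun p q => orient_lineMap p q a b _
  have h1 : 0 < orient b d e := by
    rw [he, orient_rotate, orient_left]; linarith
  have h2 : 0 < orient d a e := by
    rw [he, orient_right, ← orient_rotate d a b]; linarith
  have h3 : 0 < orient b c e := by
    rw [he, orient_rotate, orient_left]; linarith
  have h4 : 0 < orient c a e := by
    rw [he, orient_right, ← orient_rotate c a b]; linarith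
  have h5 : orient a b e = 0 := by
    rw [he, orient_left, orient_right]; ring
  obtain ⟨t, ht1, ht2, ht3, ht4, ht⟩ := ((eventually_pos_of_pos h1 (orient b d c)).and
    ((eventually_pos_of_pos h2 (orient d a c)).and
    ((eventually_pos_of_pos h3 (orient b c c)).and
    ((eventually_pos_of_pos h4 (orient c a c)).and self_mem_nhdsWithin)))).exists
  have ht : 0 < t := ht
  have hab : 0 < orient a b (e + t • (c - e)) := by
    rw [orient_lineMap, h5]
    have := mul_pos ht hc
    linarith
  refine ⟨e + t • (c - e), ⟨hab, ?_, ?_⟩, ⟨hab, ?_, ?_⟩⟩ <;> rw [orient_lineMap] <;> assumption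

theorem IsFaceFamily.third_unique (hF : IsFaceFamily P F) (hc : F a b c) (hd : F a b d) :
    c = d := by
  obtain ⟨x, h1, h2⟩ := exists_common_inside (hF.orient_pos hc) (hF.orient_pos hd)
  obtain ⟨hab, hbc, hca⟩ := ne_of_orient_pos (hF.orient_pos hc)
  rcases hF.disjoint hc hd h1 h2 with ⟨-, -, h⟩ | ⟨h, -, -⟩ | ⟨h, -, -⟩
  · exact h.symm
  · exact absurd h hab
  · exact absurd h.symm hca

/-- If `mn` becomes a hull edge once the hull vertex `a` between them is deleted, no other hull edge
appears. -/
theorem HullEdge.of_erase_or (hP : OrientGeneral P) (hma : HullEdge P m a) (han : HullEdge P a n)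
    (hmn : HullEdge (P.erase a) m n) (h : HullEdge (P.erase a) p q) :
    HullEdge P p q ∨ (p = m ∧ q = n) := by
  have ha := hma.right_mem
  rcases h.visible_or hP ha with h' | h'
  · exact Or.inl h'
  right
  have hman : 0 < orient m a n := hma.pos han.right_mem hmn.ne.symm han.ne.symm
  -- Writing `s` in barycentric coordinates of `man` and applying `orient p q`, the negative value
  -- at `a` forces a nonnegative weight on `a`. So `s` is on or beyond `mn`, hence an endpoint of
  -- that hull edge.
  have key : ∀ s ∈ P.erase a, orient p q s = 0 → s = m ∨ s = n := by
    intro s hs hs0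
    have e := orient_barycentric m a n s p q
    have e1 := mul_nonneg (han.nonneg (Finset.mem_of_mem_erase hs)) (h.nonneg hmn.left_mem)
    have e2 := mul_nonneg (hma.nonneg (Finset.mem_of_mem_erase hs)) (h.nonneg hmn.right_mem)
    refine hmn.eq_or_of_nonpos hs ?_
    rw [hs0, mul_zero] at e
    have e3 : 0 ≤ -orient p q a * orient n m s → 0 ≤ orient n m s :=
      (mul_nonneg_iff_of_pos_left (by linarith [h'.2])).1
    by_contra! hcon
    have e4 : orient n m s < 0 := by rw [orient_swap]; linarith
    have := mul_pos_of_neg_of_neg e4 h'.2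
    linarith
  rcases key p h.left_mem (by simp) with rfl | rfl <;>
  rcases key q h.right_mem (by simp) with rfl | rfl
  · exact absurd rfl h.ne
  · exact ⟨rfl, rfl⟩
  · have := h'.2
    simp only [orient] at this hman
    linarith
  · exact absurd rfl h.ne

/-- Adding a vertex `a` beyond the side `mn` of the face `mnx` and flipping `mn` to `ax`. -/
def flipFaces (m a n x : Plane) (F : Plane → Plane → Plane → Prop) (p q r : Plane) : Prop :=
  (F p q r ∧ ¬ SameTriangle m n x p q r) ∨
    Rotations (fun p q r => p = m ∧ q = a ∧ r = x) p q r ∨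
    Rotations (fun p q r => p = a ∧ q = n ∧ r = x) p q r

/-- The quadrilateral `manx` is convex, so exchanging its diagonals is legitimate. The new diagonal
`ax` is no chord because `x` is not a hull vertex. A triangle of edges through `a` uses two of `m`,
`n`, `x`; the edge `mn` is gone, so only the two new faces remain. -/
theorem IsFaceFamily.flip (hP : OrientGeneral P) (h3 : 2 < P.card)
    (hT : HullNotTriangle (P.erase a)) (hma : HullEdge P m a) (han : HullEdge P a n)
    (hmn : HullEdge (P.erase a) m n) (hF : IsFaceFamily (P.erase a) F) (hx : F m n x) :
    IsFaceFamily P (flipFaces m a n x F) := by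
  have ha := hma.right_mem
  have hmnx := hF.orient_pos hx
  have hx' := Finset.mem_erase.1 (hF.mem (hF.rotate (hF.rotate hx)))
  obtain ⟨hmn', hnx, hxm⟩ := ne_of_orient_pos hmnx
  have hman : 0 < orient m a n := hma.pos han.right_mem hmn'.symm han.ne.symm
  have hmax : 0 < orient m a x := hma.pos hx'.2 hxm hx'.1
  have hanx : 0 < orient a n x := han.pos hx'.2 hx'.1 hnx.symm
  -- If `x` were a hull vertex, the absence of chords would make `mnx` a triangular hull of `P \
  -- {a}`.
  have hxhull : ¬ HullVertex (P.erase a) x := by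
    intro hxh
    rcases hF.chord ⟨m, Or.inl (hF.rotate hx)⟩ hmn.right hxh with h | h
    · rcases hF.chord ⟨n, Or.inl (hF.rotate (hF.rotate hx))⟩ hxh hmn.left with h' | h'
      · exact hT _ _ _ hmn h h'
      · exact hnx (hmn.right_unique h')
    · exact hxm (h.left_unique hmn)
  have hxhull' : ¬ HullVertex P x := fun h => hxhull (h.erase hP h3 hx'.1)
  have hne : ∀ {p q}, Edge F p q → p ≠ a ∧ q ≠ a := fun h =>
    ⟨Finset.ne_of_mem_erase (hF.mem_left h), Finset.ne_of_mem_erase (hF.mem_right h)⟩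
  have hrev : ∀ r, ¬ F n m r := by
    intro r h
    have h1 := hF.orient_pos h
    have h2 := hmn.nonneg (hF.mem (hF.rotate (hF.rotate h)))
    rw [orient_swap] at h1
    linarith
  have hedge : ∀ {p q}, Edge (flipFaces m a n x F) p q →
      (Edge F p q ∧ ¬ (p = m ∧ q = n) ∧ ¬ (p = n ∧ q = m)) ∨
      (p = a ∧ (q = m ∨ q = n ∨ q = x)) ∨ (q = a ∧ (p = m ∨ p = n ∨ p = x)) := by
    have key : ∀ {p q r}, flipFaces m a n x F p q r →
      (Edge F p q ∧ ¬ (p = m ∧ q = n) ∧ ¬ (p = n ∧ q = m)) ∨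
      (p = a ∧ (q = m ∨ q = n ∨ q = x)) ∨ (q = a ∧ (p = m ∨ p = n ∨ p = x)) := by
      rintro p q r (⟨h, hs⟩ | (⟨rfl, rfl, rfl⟩ | ⟨rfl, rfl, rfl⟩ | ⟨rfl, rfl, rfl⟩) |
        (⟨rfl, rfl, rfl⟩ | ⟨rfl, rfl, rfl⟩ | ⟨rfl, rfl, rfl⟩))
      · refine Or.inl ⟨⟨r, Or.inl h⟩, ?_, ?_⟩
        · rintro ⟨rfl, rfl⟩
          exact hs (Or.inl ⟨rfl, rfl, hF.third_unique h hx⟩)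
        · rintro ⟨rfl, rfl⟩
          exact hrev _ h
      · exact Or.inr (Or.inr ⟨rfl, Or.inl rfl⟩)
      · exact Or.inl ⟨⟨n, Or.inl (hF.rotate (hF.rotate hx))⟩, fun h => hxm h.1,
          fun h => hnx h.1.symm⟩
      · exact Or.inr (Or.inl ⟨rfl, Or.inr (Or.inr rfl)⟩)
      · exact Or.inr (Or.inl ⟨rfl, Or.inr (Or.inl rfl)⟩)
      · exact Or.inr (Or.inr ⟨rfl, Or.inr (Or.inr rfl)⟩)
      · exact Or.inl ⟨⟨m, Or.inl (hF.rotate hx)⟩, fun h => hmn' h.1.symm, fun h => hxm h.2⟩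
    rintro p q ⟨r, h | h⟩
    · exact key h
    · rcases key h with ⟨h, h1, h2⟩ | h | h
      · exact Or.inl ⟨h.symm, fun e => h2 e.symm, fun e => h1 e.symm⟩
      · exact Or.inr (Or.inr h)
      · exact Or.inr (Or.inl h)
  have hrot : ∀ {p q r}, flipFaces m a n x F p q r → flipFaces m a n x F q r p := by
    rintro p q r (⟨h, hs⟩ | h | h)
    · exact Or.inl ⟨hF.rotate h, fun h' => hs h'.of_rotate⟩
    · exact Or.inr (Or.inl h.rotate)
    · exact Or.inr (Or.inr h.rotate)
  have hface1 : flipFaces m a n x F m a x := Or.inr (Or.inl (Or.inl ⟨rfl, rfl, rfl⟩))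
  have hface2 : flipFaces m a n x F a n x := Or.inr (Or.inr (Or.inl ⟨rfl, rfl, rfl⟩))
  -- The parts of the new triangles on the inner side of `mn` lie in the old face `mnx`, so
  -- emptiness and disjointness are inherited from it.
  have hin1 : ∀ {y}, Inside m a x y → 0 < orient m n y → Inside m n x y := fun hy h0 =>
    ⟨h0, hy.pos (by rw [orient_rotate]; exact hmnx.le) (by rw [orient_rotate]; exact hanx.le)
      (by simp) (Or.inl (by rwa [orient_rotate])), hy.2.2⟩
  have hin2 : ∀ {y}, Inside a n x y → 0 < orient m n y → Inside m n x y := fun hy h0 =>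
    ⟨h0, hy.2.1, hy.pos (by rw [← orient_rotate x m a]; exact hmax.le)
      (by rw [← orient_rotate x m n]; exact hmnx.le) (by simp)
      (Or.inl (by rwa [← orient_rotate x m a]))⟩
  refine ⟨hrot, ?_, ?_, ?_, ?_, ?_, ?_, ?_, ?_⟩
  · rintro p q r (⟨h, -⟩ | (⟨rfl, rfl, rfl⟩ | ⟨rfl, rfl, rfl⟩ | ⟨rfl, rfl, rfl⟩) |
        (⟨rfl, rfl, rfl⟩ | ⟨rfl, rfl, rfl⟩ | ⟨rfl, rfl, rfl⟩))
    exacts [Finset.mem_of_mem_erase (hF.mem h), hma.left_mem, hx'.2, ha, ha, hx'.2, han.right_mem]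
  · rintro p q r (⟨h, -⟩ | (⟨rfl, rfl, rfl⟩ | ⟨rfl, rfl, rfl⟩ | ⟨rfl, rfl, rfl⟩) |
        (⟨rfl, rfl, rfl⟩ | ⟨rfl, rfl, rfl⟩ | ⟨rfl, rfl, rfl⟩))
    · exact hF.orient_pos h
    · exact hmax
    · rwa [← orient_rotate]
    · rwa [orient_rotate]
    · exact hanx
    · rwa [← orient_rotate]
    · rwa [orient_rotate]
  · have key1 : ∀ p ∈ P, ¬ Inside m a x p := by
      intro p hp hin
      have hpa : p ≠ a := by rintro rfl; simpa using hin.1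
      have hpm : p ≠ m := by rintro rfl; simpa using hin.1
      have hpn : p ≠ n := by
        rintro rfl
        have := hin.2.1
        rw [orient_swap_right] at this
        linarith
      have hp' := Finset.mem_erase.2 ⟨hpa, hp⟩
      exact hF.empty hx p hp' (hin1 hin (hmn.pos hp' hpm hpn))
    have key2 : ∀ p ∈ P, ¬ Inside a n x p := by
      intro p hp hin
      have hpa : p ≠ a := by rintro rfl; simpa using hin.1
      have hpn : p ≠ n := by rintro rfl; simpa using hin.1
      have hpm : p ≠ m := by
        rintro rfl
        have := hin.2.2
        simp only [orient] at this hmax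
        linarith
      have hp' := Finset.mem_erase.2 ⟨hpa, hp⟩
      exact hF.empty hx p hp' (hin2 hin (hmn.pos hp' hpm hpn))
    rintro p q r (⟨h, -⟩ | (⟨rfl, rfl, rfl⟩ | ⟨rfl, rfl, rfl⟩ | ⟨rfl, rfl, rfl⟩) |
        (⟨rfl, rfl, rfl⟩ | ⟨rfl, rfl, rfl⟩ | ⟨rfl, rfl, rfl⟩)) s hs hin
    · by_cases hsa : s = a
      · subst hsa
        exact hma.right.not_inside (Finset.mem_of_mem_erase (hF.mem h))
          (Finset.mem_of_mem_erase (hF.mem (hF.rotate h)))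
          (Finset.mem_of_mem_erase (hF.mem (hF.rotate (hF.rotate h)))) hin
      · exact hF.empty h s (Finset.mem_erase.2 ⟨hsa, hs⟩) hin
    · exact key1 s hs hin
    · exact key1 s hs hin.rotate
    · exact key1 s hs hin.rotate.rotate
    · exact key2 s hs hin
    · exact key2 s hs hin.rotate
    · exact key2 s hs hin.rotate.rotate
  · intro y hy hin
    -- Inside the quadrilateral `manx`, the side of `ax` decides which new face contains `y`.
    have hfin : 0 < orient x m y → 0 < orient n x y →
        ∃ p q r, flipFaces m a n x F p q r ∧ Inside p q r y := by
      intro h1 h2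
      rcases lt_or_gt_of_ne (hy a ha x hx'.2 hx'.1.symm) with h0 | h0
      · exact ⟨a, n, x, hface2, hin a n han, h2, by rw [orient_swap]; linarith⟩
      · exact ⟨m, a, x, hface1, hin m a hma, h0, h1⟩
    rcases lt_or_gt_of_ne (hy m hma.left_mem n han.right_mem hmn') with h0 | h0
    · have hi : Inside m a n y := ⟨hin m a hma, hin a n han, by rw [orient_swap]; linarith⟩
      refine hfin (hi.pos (by simp) ?_ ?_ (Or.inr (Or.inl ?_)))
        (hi.pos ?_ ?_ (by simp) (Or.inl ?_))
      all_goals simp only [orient] at hmax hanx hmnx ⊢; linarith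
    · obtain ⟨p, q, r, hf, hi⟩ := hF.cover y (hy.erase a) (fun p q hpq => by
        rcases HullEdge.of_erase_or hP hma han hmn hpq with h | ⟨rfl, rfl⟩
        · exact hin p q h
        · exact h0)
      by_cases hs : SameTriangle m n x p q r
      · rcases hs with ⟨rfl, rfl, rfl⟩ | ⟨rfl, rfl, rfl⟩ | ⟨rfl, rfl, rfl⟩
        · exact hfin hi.2.2 hi.2.1
        · exact hfin hi.2.1 hi.1
        · exact hfin hi.1 hi.2.2
      · exact ⟨p, q, r, Or.inl ⟨hf, hs⟩, hi⟩
  · have hold : ∀ {p q r s}, F p q r → Inside p q r s → 0 < orient m n s := fun hf hi =>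
      hmn.inside_pos (hF.mem hf) (hF.mem (hF.rotate hf)) (hF.mem (hF.rotate (hF.rotate hf))) hi
    have old1 : ∀ {p q r s}, F p q r → ¬ SameTriangle m n x p q r → Inside p q r s →
        ¬ Inside m a x s := fun hf hs hi hi' =>
      hs (hF.disjoint hx hf (hin1 hi' (hold hf hi)) hi)
    have old2 : ∀ {p q r s}, F p q r → ¬ SameTriangle m n x p q r → Inside p q r s →
        ¬ Inside a n x s := fun hf hs hi hi' =>
      hs (hF.disjoint hx hf (hin2 hi' (hold hf hi)) hi)
    have new : ∀ {s}, Inside m a x s → ¬ Inside a n x s := by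
      intro s h1 h2
      have e1 := h1.2.1
      have e2 := h2.2.2
      rw [orient_swap] at e2
      linarith
    have key : ∀ {p q r s}, flipFaces m a n x F p q r → Inside p q r s →
        (F p q r ∧ ¬ SameTriangle m n x p q r) ∨ (SameTriangle m a x p q r ∧ Inside m a x s) ∨
        (SameTriangle a n x p q r ∧ Inside a n x s) := by
      rintro p q r s (h | (⟨rfl, rfl, rfl⟩ | ⟨rfl, rfl, rfl⟩ | ⟨rfl, rfl, rfl⟩) |
        (⟨rfl, rfl, rfl⟩ | ⟨rfl, rfl, rfl⟩ | ⟨rfl, rfl, rfl⟩)) hi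
      · exact Or.inl h
      · exact Or.inr (Or.inl ⟨Or.inl ⟨rfl, rfl, rfl⟩, hi⟩)
      · exact Or.inr (Or.inl ⟨Or.inr (Or.inr ⟨rfl, rfl, rfl⟩), hi.rotate⟩)
      · exact Or.inr (Or.inl ⟨Or.inr (Or.inl ⟨rfl, rfl, rfl⟩), hi.rotate.rotate⟩)
      · exact Or.inr (Or.inr ⟨Or.inl ⟨rfl, rfl, rfl⟩, hi⟩)
      · exact Or.inr (Or.inr ⟨Or.inr (Or.inr ⟨rfl, rfl, rfl⟩), hi.rotate⟩)
      · exact Or.inr (Or.inr ⟨Or.inr (Or.inl ⟨rfl, rfl, rfl⟩), hi.rotate.rotate⟩)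
    intro p q r p' q' r' s h h' hi hi'
    rcases key h hi with ⟨k, k1⟩ | ⟨k, k1⟩ | ⟨k, k1⟩ <;>
    rcases key h' hi' with ⟨k', k1'⟩ | ⟨k', k1'⟩ | ⟨k', k1'⟩
    · exact hF.disjoint k k' hi hi'
    · exact absurd k1' (old1 k k1 hi)
    · exact absurd k1' (old2 k k1 hi)
    · exact absurd k1 (old1 k' k1' hi')
    · exact k.trans_left k'
    · exact absurd k1' (new k1)
    · exact absurd k1 (old2 k' k1' hi')
    · exact absurd k1 (new k1')
    · exact k.trans_left k'
  · intro p q h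
    by_cases hpa : p = a
    · subst hpa
      have := h.right_unique han
      subst this
      exact ⟨x, hface2⟩
    by_cases hqa : q = a
    · subst hqa
      have := h.left_unique hma
      subst this
      exact ⟨x, hface1⟩
    obtain ⟨c, hc⟩ := hF.hull (h.erase hpa hqa)
    refine ⟨c, Or.inl ⟨hc, ?_⟩⟩
    rintro (⟨rfl, rfl, rfl⟩ | ⟨rfl, rfl, rfl⟩ | ⟨rfl, rfl, rfl⟩)
    · have := h.pos ha hma.ne.symm han.ne
      rw [orient_swap_right] at this
      linarith
    · exact hxhull' h.right
    · exact hxhull' h.left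
  · intro p q h hp hq
    rcases hedge h with ⟨h, h1, h2⟩ | ⟨rfl, rfl | rfl | rfl⟩ | ⟨rfl, rfl | rfl | rfl⟩
    · rcases hF.chord h (hp.erase hP h3 (hne h).1) (hq.erase hP h3 (hne h).2) with h' | h'
      · exact Or.inl ((HullEdge.of_erase_or hP hma han hmn h').resolve_right h1)
      · exact Or.inr ((HullEdge.of_erase_or hP hma han hmn h').resolve_right fun e => h2 e.symm)
    · exact Or.inr hma
    · exact Or.inl han
    · exact absurd hq hxhull'
    · exact Or.inl hma
    · exact Or.inr han
    · exact absurd hp hxhull'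
  · have key : ∀ {q r}, Edge F q r → ¬ (q = m ∧ r = n) → ¬ (q = n ∧ r = m) →
        (q = m ∨ q = n ∨ q = x) → (r = m ∨ r = n ∨ r = x) → 0 < orient a q r →
        flipFaces m a n x F a q r := by
      rintro q r he h1 h2 (rfl | rfl | rfl) (rfl | rfl | rfl) h0
      · exact absurd rfl (hF.ne he)
      · exact absurd ⟨rfl, rfl⟩ h1
      · rw [orient_swap] at h0
        linarith
      · exact absurd ⟨rfl, rfl⟩ h2
      · exact absurd rfl (hF.ne he)
      · exact hface2
      · exact hrot hface1
      · rw [orient_swap_right] at h0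
        linarith
      · exact absurd rfl (hF.ne he)
    intro p q r h1 h2 h3 h0
    obtain ⟨npq, nqr, nrp⟩ := ne_of_orient_pos h0
    rcases hedge h1 with ⟨e1, k1⟩ | ⟨rfl, e1⟩ | ⟨rfl, e1⟩
    · rcases hedge h2 with ⟨e2, k2⟩ | ⟨rfl, e2⟩ | ⟨rfl, e2⟩
      · rcases hedge h3 with ⟨e3, k3⟩ | ⟨rfl, e3⟩ | ⟨rfl, e3⟩
        · refine Or.inl ⟨hF.triangle e1 e2 e3 h0, ?_⟩
          rintro (⟨h, h', -⟩ | ⟨h, -, h'⟩ | ⟨-, h', h⟩)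
          exacts [k1.1 ⟨h, h'⟩, k3.1 ⟨h', h⟩, k2.1 ⟨h', h⟩]
        · exact absurd rfl (hne e2).2
        · exact absurd rfl (hne e1).1
      · exact absurd rfl (hne e1).2
      · rcases hedge h3 with ⟨e3, k3⟩ | ⟨-, e3⟩ | ⟨rfl, e3⟩
        · exact absurd rfl (hne e3).1
        · exact hrot (key e1 k1.1 k1.2 e3 e2 (by rwa [← orient_rotate]))
        · exact absurd rfl nrp
    · rcases hedge h2 with ⟨e2, k2⟩ | ⟨rfl, e2⟩ | ⟨rfl, e2⟩
      · rcases hedge h3 with ⟨e3, k3⟩ | ⟨rfl, e3⟩ | ⟨-, e3⟩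
        · exact absurd rfl (hne e3).2
        · exact absurd rfl nrp
        · exact key e2 k2.1 k2.2 e1 e3 h0
      · exact absurd rfl npq
      · exact absurd rfl nrp
    · rcases hedge h2 with ⟨e2, k2⟩ | ⟨-, e2⟩ | ⟨rfl, e2⟩
      · exact absurd rfl (hne e2).1
      · rcases hedge h3 with ⟨e3, k3⟩ | ⟨rfl, e3⟩ | ⟨rfl, e3⟩
        · exact hrot (hrot (key e3 k3.1 k3.2 e2 e1 (by rwa [orient_rotate])))
        · exact absurd rfl nqr
        · exact absurd rfl npq
      · exact absurd rfl nqr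

end

/-! ### Quadrilateral hulls and the wheel. -/

section

variable {P : Finset Plane} {a b c d m n u v w x y p q r : Plane}

theorem HullEdge.asymm (h3 : 2 < P.card) (h : HullEdge P a b) : ¬ HullEdge P b a := by
  intro h'
  obtain ⟨p, hp, ha, hb⟩ := exists_third h3 a b
  have h1 := h.pos hp ha hb
  have h2 := h'.pos hp hb ha
  rw [orient_swap] at h2
  linarith

theorem inside_or_of_quadrilateral (h1 : 0 < orient a b x) (h2 : 0 < orient b c x)
    (h3 : 0 < orient c d x) (h4 : 0 < orient d a x) (h0 : orient a c x ≠ 0) :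
    Inside a b c x ∨ Inside c d a x := by
  rcases lt_or_gt_of_ne h0 with h0 | h0
  · exact Or.inl ⟨h1, h2, by rw [orient_swap]; linarith⟩
  · exact Or.inr ⟨h3, h4, h0⟩

/-- The convex hull of `P` is the quadrilateral `abcd`. -/
structure HullQuad (P : Finset Plane) (a b c d : Plane) : Prop where
  ab : HullEdge P a b
  bc : HullEdge P b c
  cd : HullEdge P c d
  da : HullEdge P d a

namespace HullQuad

theorem rotate (h : HullQuad P a b c d) : HullQuad P b c d a := ⟨h.bc, h.cd, h.da, h.ab⟩

theorem ne_ac (h3 : 2 < P.card) (h : HullQuad P a b c d) : a ≠ c := by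
  rintro rfl
  exact h.ab.asymm h3 h.bc

theorem pos_abc (h3 : 2 < P.card) (h : HullQuad P a b c d) : 0 < orient a b c :=
  h.ab.pos h.bc.right_mem (h.ne_ac h3).symm h.bc.ne.symm

theorem hullVertex (hP : OrientGeneral P) (h3 : 2 < P.card) (h : HullQuad P a b c d)
    (hp : HullVertex P p) : p = a ∨ p = b ∨ p = c ∨ p = d := by
  by_contra! hne
  obtain ⟨ha, hb, hc, hd⟩ := hne
  rcases inside_or_of_quadrilateral (h.ab.pos hp.mem ha hb) (h.bc.pos hp.mem hb hc) (h.cd.pos hp.mem hc hd)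
    (h.da.pos hp.mem hd ha)
    (hP a h.ab.left_mem c h.cd.left_mem p hp.mem (h.ne_ac h3) ha.symm hc.symm) with h' | h'
  · exact hp.not_inside h.ab.left_mem h.ab.right_mem h.cd.left_mem h'
  · exact hp.not_inside h.cd.left_mem h.cd.right_mem h.ab.left_mem h'

theorem hullEdge (hP : OrientGeneral P) (h3 : 2 < P.card) (h : HullQuad P a b c d)
    (hp : HullEdge P p q) :
    (p = a ∧ q = b) ∨ (p = b ∧ q = c) ∨ (p = c ∧ q = d) ∨ (p = d ∧ q = a) := by
  rcases h.hullVertex hP h3 hp.left with rfl | rfl | rfl | rfl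
  · exact Or.inl ⟨rfl, hp.right_unique h.ab⟩
  · exact Or.inr (Or.inl ⟨rfl, hp.right_unique h.bc⟩)
  · exact Or.inr (Or.inr (Or.inl ⟨rfl, hp.right_unique h.cd⟩))
  · exact Or.inr (Or.inr (Or.inr ⟨rfl, hp.right_unique h.da⟩))

/-- An inner point `u` divides the quadrilateral into four triangles. -/
theorem inside_four (hP : OrientGeneral P) (h3 : 2 < P.card) (h : HullQuad P a b c d)
    (hu : u ∈ P) (hu' : ¬ HullVertex P u)
    (h1 : 0 < orient a b x) (h2 : 0 < orient b c x) (h3' : 0 < orient c d x)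
    (h4 : 0 < orient d a x)
    (hx : ∀ p, HullVertex P p → orient u x p ≠ 0) :
    Inside a b u x ∨ Inside b c u x ∨ Inside c d u x ∨ Inside d a u x := by
  have hne : ∀ {p}, HullVertex P p → u ≠ p := by
    rintro p hp rfl
    exact hu' hp
  have hin := inside_or_of_quadrilateral (h.ab.pos hu (hne h.ab.left) (hne h.ab.right))
    (h.bc.pos hu (hne h.bc.left) (hne h.bc.right)) (h.cd.pos hu (hne h.cd.left) (hne h.cd.right))
    (h.da.pos hu (hne h.da.left) (hne h.da.right))
    (hP a h.ab.left_mem c h.cd.left_mem u hu (h.ne_ac h3) (hne h.ab.left).symm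
      (hne h.cd.left).symm)
  have key : ∀ {p q}, 0 < orient p q x → orient u x p < 0 → 0 < orient u x q →
      Inside p q u x := by
    intro p q h1 h2 h3
    refine ⟨h1, ?_, ?_⟩
    · rw [← orient_rotate q u x]; exact h3
    · rw [orient_swap_right]; linarith
  have hall : ∀ s t, ¬ (0 < orient s t a ∧ 0 < orient s t b ∧ 0 < orient s t c ∧
      0 < orient s t d ∧ orient s t u = 0) := by
    rintro s t ⟨ha, hb, hc, hd, hu0⟩
    rcases hin with hin | hin
    · exact hu0.not_gt (hin.pos ha.le hb.le hc.le (Or.inl ha))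
    · exact hu0.not_gt (hin.pos hc.le hd.le ha.le (Or.inl hc))
  -- The line `ux` cannot have all corners on one side, since `u` is interior. Hence the cyclic sign
  -- sequence of the corners changes somewhere from negative to positive, and that side with `u`
  -- spans the triangle containing `x`.
  rcases lt_or_gt_of_ne (hx a h.ab.left) with ha | ha <;>
  rcases lt_or_gt_of_ne (hx b h.bc.left) with hb | hb <;>
  rcases lt_or_gt_of_ne (hx c h.cd.left) with hc | hc <;>
  rcases lt_or_gt_of_ne (hx d h.da.left) with hd | hd
  case inl.inl.inl.inl =>
    refine absurd ?_ (hall x u)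
    simp only [orient_swap u x]
    refine ⟨?_, ?_, ?_, ?_, ?_⟩ <;> simp <;> assumption
  case inr.inr.inr.inr =>
    exact absurd ⟨ha, hb, hc, hd, orient_left u x⟩ (hall u x)
  all_goals first
    | exact Or.inl (key h1 ha hb)
    | exact Or.inr (Or.inl (key h2 hb hc))
    | exact Or.inr (Or.inr (Or.inl (key h3' hc hd)))
    | exact Or.inr (Or.inr (Or.inr (key h4 hd ha)))

/-- The hypotheses would put `a`, `c` strictly on one side of the line `ux` and `b`, `d` on the
other, although the diagonals cross; `e` is the affine dependence expressing that crossing. -/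
theorem not_inside_opposite (h3 : 2 < P.card) (h : HullQuad P a b c d) (h1 : Inside a b u x) :
    ¬ Inside c d u x := by
  intro h2
  have e : orient b c d * orient u x a + orient d a b * orient u x c
      = orient c d a * orient u x b + orient a b c * orient u x d := by
    simp only [orient]; ring
  have k1 := h.pos_abc h3
  have k2 := h.rotate.pos_abc h3
  have k3 := h.rotate.rotate.pos_abc h3
  have k4 := h.rotate.rotate.rotate.pos_abc h3
  have e1 := mul_pos k2 h1.2.2
  have e2 := mul_pos k4 h2.2.2
  have e3 := mul_pos k3 h1.2.1
  have e4 := mul_pos k1 h2.2.1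
  rw [orient_swap_right u x a] at e1
  rw [orient_swap_right u x c] at e2
  rw [← orient_rotate b u x] at e3
  rw [← orient_rotate d u x] at e4
  linarith

end HullQuad

/-- The triangles joining `u` to the hull edges of `P`. -/
def wheel (P : Finset Plane) (u : Plane) : Plane → Plane → Plane → Prop :=
  Rotations fun x y z => HullEdge P x y ∧ z = u

/-- Every edge is a hull edge or a spoke to the inner point `u`, so there are no chords. A triangle
of edges avoiding `u` would consist of three hull edges. The faces are empty because all points
other than `u` are hull vertices. -/
theorem HullQuad.isFaceFamily_wheel (hP : OrientGeneral P) (h3 : 2 < P.card)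
    (hT : HullNotTriangle P) (h : HullQuad P a b c d) (hu : u ∈ P) (hu' : ¬ HullVertex P u)
    (hall : ∀ p ∈ P, p ≠ u → HullVertex P p) : IsFaceFamily P (wheel P u) := by
  have hne : ∀ {p}, HullVertex P p → u ≠ p := by
    rintro p hp rfl
    exact hu' hp
  have hpos : ∀ {p q}, HullEdge P p q → 0 < orient p q u := fun h =>
    h.pos hu (hne h.left) (hne h.right)
  have hedge : ∀ {p q}, Edge (wheel P u) p q →
      (HullVertex P p ∧ HullVertex P q ∧ (HullEdge P p q ∨ HullEdge P q p)) ∨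
      (p = u ∧ HullVertex P q) ∨ (q = u ∧ HullVertex P p) := by
    rintro p q ⟨r, (⟨h, e⟩ | ⟨h, e⟩ | ⟨h, e⟩) | (⟨h, e⟩ | ⟨h, e⟩ | ⟨h, e⟩)⟩
    · exact Or.inl ⟨h.left, h.right, Or.inl h⟩
    · exact Or.inr (Or.inl ⟨e, h.left⟩)
    · exact Or.inr (Or.inr ⟨e, h.right⟩)
    · exact Or.inl ⟨h.right, h.left, Or.inr h⟩
    · exact Or.inr (Or.inr ⟨e, h.left⟩)
    · exact Or.inr (Or.inl ⟨e, h.right⟩)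
  refine ⟨Rotations.rotate, ?_, ?_, ?_, ?_, ?_, ?_, ?_, ?_⟩
  · rintro x y z (⟨h, rfl⟩ | ⟨h, rfl⟩ | ⟨h, rfl⟩)
    exacts [h.left_mem, hu, h.right_mem]
  · rintro x y z (⟨h, rfl⟩ | ⟨h, rfl⟩ | ⟨h, rfl⟩)
    · exact hpos h
    · rw [← orient_rotate]; exact hpos h
    · rw [orient_rotate]; exact hpos h
  · have key : ∀ {x y}, HullEdge P x y → ∀ p ∈ P, ¬ Inside x y u p := by
      intro x y h p hp hin
      by_cases hpu : p = u
      · subst hpu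
        simpa using hin.2.1
      · exact (hall p hp hpu).not_inside h.left_mem h.right_mem hu hin
    rintro x y z (⟨h, rfl⟩ | ⟨h, rfl⟩ | ⟨h, rfl⟩) p hp hin
    · exact key h p hp hin
    · exact key h p hp hin.rotate
    · exact key h p hp hin.rotate.rotate
  · intro x hx hin
    have hx' : ∀ p, HullVertex P p → orient u x p ≠ 0 := fun p hp h0 => by
      rw [orient_swap_right, neg_eq_zero] at h0
      exact hx u hu p hp.mem (hne hp) h0
    rcases h.inside_four hP h3 hu hu' (hin _ _ h.ab) (hin _ _ h.bc) (hin _ _ h.cd)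
      (hin _ _ h.da) hx' with h' | h' | h' | h'
    exacts [⟨a, b, u, Or.inl ⟨h.ab, rfl⟩, h'⟩, ⟨b, c, u, Or.inl ⟨h.bc, rfl⟩, h'⟩,
      ⟨c, d, u, Or.inl ⟨h.cd, rfl⟩, h'⟩, ⟨d, a, u, Or.inl ⟨h.da, rfl⟩, h'⟩]
  · have adj : ∀ {p q r s}, Inside p q u s → ¬ Inside q r u s := by
      intro p q r s h1 h2
      have e1 := h1.2.1
      have e2 := h2.2.2
      rw [orient_swap] at e2
      linarith
    have key : ∀ {p q p' q' s}, HullEdge P p q → HullEdge P p' q' → Inside p q u s →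
        Inside p' q' u s → p' = p ∧ q' = q := by
      intro p q p' q' s k k' hi hi'
      rcases h.hullEdge hP h3 k with ⟨rfl, rfl⟩ | ⟨rfl, rfl⟩ | ⟨rfl, rfl⟩ | ⟨rfl, rfl⟩ <;>
      rcases h.hullEdge hP h3 k' with ⟨rfl, rfl⟩ | ⟨rfl, rfl⟩ | ⟨rfl, rfl⟩ | ⟨rfl, rfl⟩ <;>
      first
        | exact ⟨rfl, rfl⟩
        | exact absurd hi' (adj hi)
        | exact absurd hi (adj hi')
        | exact absurd hi' (h.not_inside_opposite h3 hi)
        | exact absurd hi (h.not_inside_opposite h3 hi')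
        | exact absurd hi' (h.rotate.not_inside_opposite h3 hi)
        | exact absurd hi (h.rotate.not_inside_opposite h3 hi')
    have rep : ∀ {x y z s}, wheel P u x y z → Inside x y z s →
        ∃ p q, HullEdge P p q ∧ Inside p q u s ∧ SameTriangle p q u x y z := by
      rintro x y z s (⟨h, rfl⟩ | ⟨h, rfl⟩ | ⟨h, rfl⟩) hi
      · exact ⟨x, y, h, hi, Or.inl ⟨rfl, rfl, rfl⟩⟩
      · exact ⟨y, z, h, hi.rotate, Or.inr (Or.inr ⟨rfl, rfl, rfl⟩)⟩
      · exact ⟨z, x, h, hi.rotate.rotate, Or.inr (Or.inl ⟨rfl, rfl, rfl⟩)⟩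
    intro x y z x' y' z' s hf hf' hi hi'
    obtain ⟨p, q, k, ki, ks⟩ := rep hf hi
    obtain ⟨p', q', k', ki', ks'⟩ := rep hf' hi'
    obtain ⟨rfl, rfl⟩ := key k k' ki ki'
    exact ks.trans_left ks'
  · exact fun h => ⟨u, Or.inl ⟨h, rfl⟩⟩
  · intro p q h hp hq
    rcases hedge h with ⟨-, -, h⟩ | ⟨rfl, -⟩ | ⟨rfl, -⟩
    exacts [h, absurd hp hu', absurd hq hu']
  · have key : ∀ {p q}, HullEdge P p q ∨ HullEdge P q p → 0 < orient p q u → HullEdge P p q := by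
      rintro p q (h | h) h0
      · exact h
      · have := hpos h
        rw [orient_swap] at this
        linarith
    intro p q r h1 h2 h3' h0
    obtain ⟨npq, nqr, nrp⟩ := ne_of_orient_pos h0
    rcases hedge h1 with ⟨kp, kq, e1⟩ | ⟨rfl, kq⟩ | ⟨rfl, kp⟩
    · rcases hedge h2 with ⟨-, kr, e2⟩ | ⟨rfl, -⟩ | ⟨rfl, -⟩
      · rcases hedge h3' with ⟨-, -, e3⟩ | ⟨rfl, -⟩ | ⟨rfl, -⟩
        · exfalso
          rcases e1 with e1 | e1 <;> rcases e2 with e2 | e2 <;> rcases e3 with e3 | e3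
          · exact hT _ _ _ e1 e2 e3
          · exact nqr (e1.right_unique e3)
          · exact nrp (e1.left_unique e2).symm
          · exact nrp (e1.left_unique e2).symm
          · exact nrp (e1.right_unique e2).symm
          · exact nrp (e1.right_unique e2).symm
          · exact npq (e2.right_unique e3).symm
          · exact hT _ _ _ e1 e3 e2
        · exact absurd kr hu'
        · exact absurd kp hu'
      · exact absurd kq hu'
      · exact Or.inl ⟨key e1 h0, rfl⟩
    · rcases hedge h2 with ⟨-, kr, e2⟩ | ⟨rfl, -⟩ | ⟨rfl, -⟩
      · exact Or.inr (Or.inl ⟨key e2 (by rwa [orient_rotate]), rfl⟩)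
      · exact absurd kq hu'
      · exact absurd rfl nrp
    · rcases hedge h3' with ⟨kr, -, e3⟩ | ⟨rfl, -⟩ | ⟨rfl, -⟩
      · exact Or.inr (Or.inr ⟨key e3 (by rwa [← orient_rotate]), rfl⟩)
      · exact absurd rfl nqr
      · exact absurd rfl npq

end

/-! ### The induction. -/

section

variable {P : Finset Plane} {a b c d m n u v w x y p q r : Plane}

/-- A point of `P` that is not a vertex of the convex hull. -/
def InnerPoint (P : Finset Plane) (u : Plane) : Prop :=
  u ∈ P ∧ ¬ HullVertex P u

theorem InnerPoint.ne (hu : InnerPoint P u) (h : HullVertex P p) : u ≠ p := by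
  rintro rfl
  exact hu.2 h

theorem InnerPoint.of_inside (hp : p ∈ P) (hq : q ∈ P) (hr : r ∈ P) (hu : u ∈ P)
    (h : Inside p q r u) : InnerPoint P u :=
  ⟨hu, fun h' => h'.not_inside hp hq hr h⟩

theorem two_lt_card (hab : HullEdge P a b) (hu : InnerPoint P u) : 2 < P.card := by
  have h : ({a, b, u} : Finset Plane) ⊆ P := by
    intro p hp
    simp only [Finset.mem_insert, Finset.mem_singleton] at hp
    rcases hp with rfl | rfl | rfl
    exacts [hab.left_mem, hab.right_mem, hu.1]
  have h' : ({a, b, u} : Finset Plane).card = 3 :=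
    Finset.card_eq_three.2 ⟨a, b, u, hab.ne, (hu.ne hab.left).symm, (hu.ne hab.right).symm, rfl⟩
  have := Finset.card_le_card h
  omega

/-- Count the sides of a triangular hull of `P \ {a}` visible from `a`. With none, `P` has the same
hull triangle; with one, that side is `mn` and `w` lies beyond it; with two, `a` replaces their
common vertex in a hull triangle of `P`; three is impossible, as the signed areas add up to a
nonnegative number. -/
theorem HullNotTriangle.erase_of_exposed (hP : OrientGeneral P) (h3 : 2 < P.card)
    (hT : HullNotTriangle P) (hma : HullEdge P m a) (han : HullEdge P a n) (hw : w ∈ P)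
    (hwa : w ≠ a) (hmn : orient m n w < 0) : HullNotTriangle (P.erase a) := by
  have ha := hma.right_mem
  have key1 : ∀ {p q r}, VisibleEdge P a p q → HullEdge P q r → ¬ HullEdge P r p := by
    intro p q r h1 h2 h3'
    have e1 := (h1.left_edge hP h3 ha h3'.right).left_unique hma
    have e2 := (h1.right_edge hP h3 ha h2.left).right_unique han
    subst e1 e2
    exact (h1.1.nonneg (Finset.mem_erase.2 ⟨hwa, hw⟩)).not_gt hmn
  have key2 : ∀ {p q r}, HullEdge P r p → VisibleEdge P a p q → ¬ VisibleEdge P a q r := by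
    intro p q r h1 h2 h3'
    exact hT _ _ _ (h3'.right_edge hP h3 ha h1.left) h1 (h2.left_edge hP h3 ha h1.right)
  intro p q r h1 h2 h3'
  rcases h1.visible_or hP ha with k1 | k1 <;> rcases h2.visible_or hP ha with k2 | k2 <;>
  rcases h3'.visible_or hP ha with k3 | k3
  · exact hT _ _ _ k1 k2 k3
  · exact key1 k3 k1 k2
  · exact key1 k2 k3 k1
  · exact key2 k1 k2 k3
  · exact key1 k1 k2 k3
  · exact key2 k2 k3 k1
  · exact key2 k3 k1 k2
  · have := orient_sum p q r a
    have := h1.nonneg h2.right_mem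
    linarith [k1.2, k2.2, k3.2]

/-- The only new hull edge is `mn`, so a hull triangle of `P \ {a}` either was one of `P` or comes
from a quadrilateral hull by cutting off `a`. -/
theorem HullNotTriangle.erase_of_not_quad (hP : OrientGeneral P)
    (hT : HullNotTriangle P) (hQ : ∀ a b c d, ¬ HullQuad P a b c d) (hma : HullEdge P m a)
    (han : HullEdge P a n) (hmn : HullEdge (P.erase a) m n) : HullNotTriangle (P.erase a) := by
  have key : ∀ {r}, HullEdge (P.erase a) n r → ¬ HullEdge (P.erase a) r m := by
    intro r h1 h2
    rcases HullEdge.of_erase_or hP hma han hmn h1 with k1 | ⟨k1, -⟩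
    · rcases HullEdge.of_erase_or hP hma han hmn h2 with k2 | ⟨-, k2⟩
      · exact hQ m a n r ⟨hma, han, k1, k2⟩
      · exact hmn.ne k2
    · exact hmn.ne k1.symm
  intro p q r h1 h2 h3
  rcases HullEdge.of_erase_or hP hma han hmn h1 with k1 | ⟨rfl, rfl⟩
  · rcases HullEdge.of_erase_or hP hma han hmn h2 with k2 | ⟨rfl, rfl⟩
    · rcases HullEdge.of_erase_or hP hma han hmn h3 with k3 | ⟨rfl, rfl⟩
      · exact hT _ _ _ k1 k2 k3
      · exact key h1 h2
    · exact key h3 h1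
  · exact key h2 h3

/-- If there are two inner points, deleting one of two adjacent vertices of a quadrilateral hull
leaves an inner point. -/
theorem HullQuad.exists_inner_erase (hP : OrientGeneral P) (h3 : 2 < P.card)
    (h : HullQuad P a b c d) (hu : InnerPoint P u) (hv : InnerPoint P v) (huv : u ≠ v) :
    (∃ s, InnerPoint (P.erase a) s) ∨ ∃ s, InnerPoint (P.erase b) s := by
  have nab := h.ab.ne
  have nbc := h.bc.ne
  have ncd := h.cd.ne
  have nda := h.da.ne
  have nac := h.ne_ac h3
  have nbd := h.rotate.ne_ac h3
  have ma := h.ab.left_mem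
  have mb := h.bc.left_mem
  have mc := h.cd.left_mem
  have md := h.da.left_mem
  -- Of the four triangles at `u`, only `abu` uses both `a` and `b`; if `v` lies in another one,
  -- that triangle survives a deletion and keeps `v` inner. It remains to exclude `v` in `abu`
  -- together with `u` in `abv`.
  have key : ∀ {u v}, InnerPoint P u → InnerPoint P v → u ≠ v → Inside a b u v ∨
      (∃ s, InnerPoint (P.erase a) s) ∨ ∃ s, InnerPoint (P.erase b) s := by
    intro u v hu hv huv
    have ua := hu.ne h.ab.left
    have ub := hu.ne h.bc.left
    have uc := hu.ne h.cd.left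
    have ud := hu.ne h.da.left
    have va := hv.ne h.ab.left
    have vb := hv.ne h.bc.left
    have vc := hv.ne h.cd.left
    have vd := hv.ne h.da.left
    rcases h.inside_four hP h3 hu.1 hu.2 (h.ab.pos hv.1 va vb) (h.bc.pos hv.1 vb vc)
      (h.cd.pos hv.1 vc vd) (h.da.pos hv.1 vd va) (fun p hp => hP u hu.1 v hv.1 p hp.mem huv
      (hu.ne hp) (hv.ne hp)) with k | k | k | k
    · exact Or.inl k
    · refine Or.inr (Or.inl ⟨v, InnerPoint.of_inside (p := b) (q := c) (r := u) ?_ ?_ ?_ ?_ k⟩) <;>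
        simp [*, hu.1, hv.1, nab.symm, nac.symm]
    · refine Or.inr (Or.inl ⟨v, InnerPoint.of_inside (p := c) (q := d) (r := u) ?_ ?_ ?_ ?_ k⟩) <;>
        simp [*, hu.1, hv.1, nac.symm]
    · refine Or.inr (Or.inr ⟨v, InnerPoint.of_inside (p := d) (q := a) (r := u) ?_ ?_ ?_ ?_ k⟩) <;>
        simp [*, hu.1, hv.1, nbd.symm]
  rcases key hu hv huv with k1 | k1
  · rcases key hv hu huv.symm with k2 | k2
    · have e1 := k1.2.1
      have e2 := k2.2.1
      rw [orient_swap_right] at e2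
      linarith
    · exact k2
  · exact k1

/-- A point set in general position whose convex hull is not a triangle and which has an inner
point admits a noncomplex triangulation. -/
theorem exists_isFaceFamily : ∀ (k : ℕ) (P : Finset Plane), P.card = k → OrientGeneral P →
    HullNotTriangle P → (∃ a b, HullEdge P a b) → (∃ u, InnerPoint P u) →
    ∃ F, IsFaceFamily P F := by
  intro k
  induction k with
  | zero =>
    rintro P hk - - - ⟨u, hu, -⟩
    simp [Finset.card_eq_zero.1 hk] at hu
  | succ k ih =>
    rintro P hk hP hT ⟨a₀, b₀, h₀⟩ ⟨u, hu⟩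
    have h3 := two_lt_card h₀ hu
    have hfan : ∀ {m a n w}, HullEdge P m a → HullEdge P a n → w ∈ P → w ≠ a →
        orient m n w < 0 → (∃ s, InnerPoint (P.erase a) s) → ∃ F, IsFaceFamily P F := by
      intro m a n w hma han hw hwa hmn hs
      obtain ⟨v, hv, -⟩ := han.exists_erase_left hP (exists_third h3 _ _)
      obtain ⟨F, hF⟩ := ih (P.erase a)
        (by rw [Finset.card_erase_of_mem han.left_mem, hk]; rfl) (hP.erase a)
        (hT.erase_of_exposed hP h3 hma han hw hwa hmn) ⟨_, _, hv⟩ hs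
      exact ⟨_, hF.fan hP h3 hT hma han hw hwa hmn⟩
    -- Case 1: every ear contains a further point. Any `a₀` can be removed for a fan, provided an
    -- inner point survives.
    by_cases hear : ∀ m a n, HullEdge P m a → HullEdge P a n → ∃ w ∈ P, w ≠ a ∧ orient m n w < 0
    · obtain ⟨n, han⟩ := h₀.left.exists_next hP h3
      obtain ⟨m, hma⟩ := h₀.left.exists_prev hP h3
      obtain ⟨c, hnc⟩ := han.right.exists_next hP h3
      obtain ⟨e, hce⟩ := hnc.right.exists_next hP h3
      obtain ⟨w, hw, hwa, hmn⟩ := hear _ _ _ hma han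
      refine hfan hma han hw hwa hmn ?_
      -- The survivor comes from the ear at `c`, two steps further along; its corners avoid `a₀`
      -- because the hull is not a triangle.
      obtain ⟨s, hs, hsc, hne⟩ := hear _ _ _ hnc hce
      have hca : c ≠ a₀ := by
        rintro rfl
        exact han.asymm h3 hnc
      have hea : e ≠ a₀ := by
        rintro rfl
        exact hT _ _ _ han hnc hce
      have hin : Inside n c e s :=
        ⟨hnc.pos hs (by rintro rfl; simp at hne) hsc, hce.pos hs hsc (by rintro rfl; simp at hne),
          by rw [orient_swap]; linarith⟩
      have hsa : s ≠ a₀ := by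
        rintro rfl
        exact han.left.not_inside hnc.left_mem hnc.right_mem hce.right_mem hin
      exact ⟨s, InnerPoint.of_inside (Finset.mem_erase.2 ⟨han.ne.symm, hnc.left_mem⟩)
        (Finset.mem_erase.2 ⟨hca, hnc.right_mem⟩) (Finset.mem_erase.2 ⟨hea, hce.right_mem⟩)
        (Finset.mem_erase.2 ⟨hsa, hs⟩) hin⟩
    -- Case 2: some ear is empty. Unless the hull is a quadrilateral, cutting the ear off keeps the
    -- induction hypotheses, and a flip restores `a`.
    by_cases hQ : ∀ a b c d, ¬ HullQuad P a b c d
    · push Not at hear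
      obtain ⟨m, a, n, hma, han, hno⟩ := hear
      have hmn' : m ≠ n := by
        rintro rfl
        exact han.asymm h3 hma
      have hmn : HullEdge (P.erase a) m n := by
        refine ⟨Finset.mem_erase.2 ⟨hma.ne, hma.left_mem⟩,
          Finset.mem_erase.2 ⟨han.ne.symm, han.right_mem⟩, hmn', fun p hp hpm hpn => ?_⟩
        obtain ⟨hpa, hp⟩ := Finset.mem_erase.1 hp
        exact hP.pos_of_nonneg hma.left_mem han.right_mem hp hmn' hpm.symm hpn.symm
          (hno p hp hpa)
      have hT' := hT.erase_of_not_quad hP hQ hma han hmn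
      have hu' : InnerPoint (P.erase a) u := by
        refine ⟨Finset.mem_erase.2 ⟨hu.ne han.left, hu.1⟩, ?_⟩
        rintro ⟨v, h | h⟩
        · rcases HullEdge.of_erase_or hP hma han hmn h with h' | ⟨h', -⟩
          · exact hu.2 h'.left
          · exact hu.ne hma.left h'
        · rcases HullEdge.of_erase_or hP hma han hmn h with h' | ⟨-, h'⟩
          · exact hu.2 h'.right
          · exact hu.ne han.right h'
      obtain ⟨F, hF⟩ := ih (P.erase a)
        (by rw [Finset.card_erase_of_mem han.left_mem, hk]; rfl) (hP.erase a) hT' ⟨_, _, hmn⟩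
        ⟨u, hu'⟩
      obtain ⟨x, hx⟩ := hF.hull hmn
      exact ⟨_, hF.flip hP h3 hT' hma han hmn hx⟩
    push Not at hQ
    obtain ⟨a, b, c, d, h⟩ := hQ
    by_cases hone : ∀ p ∈ P, p ≠ u → HullVertex P p
    · exact ⟨_, h.isFaceFamily_wheel hP h3 hT hu.1 hu.2 hone⟩
    push Not at hone
    obtain ⟨v, hv, hvu, hv'⟩ := hone
    -- The diagonals place `u` in the ears of two adjacent corners, here `a` and `b`. A fan is
    -- possible at both, and one of the deletions leaves an inner point. The four sign patterns
    -- below are rotations of this one.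
    have key : ∀ {a b c d}, HullQuad P a b c d → orient d b u < 0 → orient a c u < 0 →
        ∃ F, IsFaceFamily P F := by
      intro a b c d h h1 h2
      rcases h.exists_inner_erase hP h3 hu ⟨hv, hv'⟩ hvu.symm with hs | hs
      · exact hfan h.da h.ab hu.1 (hu.ne h.ab.left) h1 hs
      · exact hfan h.ab h.bc hu.1 (hu.ne h.bc.left) h2 hs
    rcases lt_or_gt_of_ne (hP d h.da.left_mem b h.bc.left_mem u hu.1 (h.rotate.ne_ac h3).symm
      (hu.ne h.da.left).symm (hu.ne h.bc.left).symm) with h1 | h1 <;>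
    rcases lt_or_gt_of_ne (hP a h.ab.left_mem c h.cd.left_mem u hu.1 (h.ne_ac h3)
      (hu.ne h.ab.left).symm (hu.ne h.cd.left).symm) with h2 | h2
    · exact key h h1 h2
    · exact key h.rotate.rotate.rotate (by rw [orient_swap]; linarith) h1
    · exact key h.rotate h2 (by rw [orient_swap]; linarith)
    · exact key h.rotate.rotate (by rw [orient_swap]; linarith) (by rw [orient_swap]; linarith)

end

/-! ### Generic points and the hull as an intersection of half-planes. -/

open Filter Topology

section

variable {P : Finset Plane} {a b c d p q r x y : Plane}

@[fun_prop]
theorem continuous_orient (a b : Plane) : Continuous (orient a b) := by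
  unfold orient
  fun_prop

theorem isOpen_orient_pos (a b : Plane) : IsOpen {x | 0 < orient a b x} :=
  isOpen_lt continuous_const (continuous_orient a b)

theorem isClosed_orient_nonneg (a b : Plane) : IsClosed {x | 0 ≤ orient a b x} :=
  isClosed_le continuous_const (continuous_orient a b)

theorem orient_convexCombination (a b x y : Plane) {s t : ℝ} (hst : s + t = 1) :
    orient a b (s • x + t • y) = s * orient a b x + t * orient a b y := by
  obtain rfl : s = 1 - t := by linarith
  simp only [orient, PiLp.add_apply, PiLp.smul_apply, smul_eq_mul]
  ring

theorem convex_orient_nonneg (a b : Plane) : Convex ℝ {x | 0 ≤ orient a b x} := by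
  intro x hx y hy s t hs ht hst
  simp only [Set.mem_ofPred_eq] at *
  rw [orient_convexCombination _ _ _ _ hst]
  positivity

theorem convex_orient_pos (a b : Plane) : Convex ℝ {x | 0 < orient a b x} := by
  intro x hx y hy s t hs ht hst
  simp only [Set.mem_ofPred_eq] at *
  rw [orient_convexCombination _ _ _ _ hst]
  rcases hs.eq_or_lt with rfl | hs
  · obtain rfl : t = 1 := by linarith
    simpa using hy
  · have := mul_pos hs hx
    have := mul_nonneg ht hy.le
    linarith

theorem exists_eq_lineMap_of_orient_eq_zero (hab : a ≠ b) (h : orient a b x = 0) :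
    ∃ t : ℝ, x = a + t • (b - a) := by
  have hD : (b 0 - a 0) ^ 2 + (b 1 - a 1) ^ 2 ≠ 0 := by
    intro hD
    apply hab
    ext i
    fin_cases i <;> simp <;> nlinarith [sq_nonneg (b 0 - a 0), sq_nonneg (b 1 - a 1)]
  refine ⟨((x 0 - a 0) * (b 0 - a 0) + (x 1 - a 1) * (b 1 - a 1)) /
    ((b 0 - a 0) ^ 2 + (b 1 - a 1) ^ 2), ?_⟩
  simp only [orient] at h
  ext i
  fin_cases i <;> simp only [Fin.zero_eta, Fin.mk_one, PiLp.add_apply, PiLp.smul_apply,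
    PiLp.sub_apply, smul_eq_mul] <;> field_simp
  · linear_combination (-(b 1 - a 1)) * h
  · linear_combination (b 0 - a 0) * h

theorem GeneralPosition.orientGeneral (hP : GeneralPosition P) : OrientGeneral P := by
  intro a ha b hb c hc hab hac hbc h
  refine hP a ha b hb c hc hab hac hbc ?_
  rw [collinear_iff_of_mem (p₀ := a) (by simp)]
  obtain ⟨t, ht⟩ := exists_eq_lineMap_of_orient_eq_zero hab h
  refine ⟨b - a, ?_⟩
  rintro p (rfl | rfl | rfl)
  · exact ⟨0, by simp⟩
  · exact ⟨1, by simp⟩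
  · exact ⟨t, by rw [vadd_eq_add, add_comm]; exact ht⟩

theorem tendsto_add_smul (x v : Plane) :
    Tendsto (fun t : ℝ => x + t • v) (𝓝[>] 0) (𝓝 x) := by
  have hc : Continuous fun t : ℝ => x + t • v := by fun_prop
  have := hc.tendsto 0
  simp only [zero_smul, add_zero] at this
  exact this.mono_left nhdsWithin_le_nhds

theorem dense_orient_ne_zero (hpq : p ≠ q) : Dense {x | orient p q x ≠ 0} := by
  obtain ⟨y, hy⟩ : ∃ y, orient p q y ≠ 0 := by
    by_contra! hall
    have h1 := hall (p + !₂[1, 0])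
    have h2 := hall (p + !₂[0, 1])
    simp [orient] at h1 h2
    apply hpq
    ext i
    fin_cases i <;> simp <;> linarith
  intro x
  by_cases hx : orient p q x = 0
  · refine mem_closure_of_tendsto (tendsto_add_smul x (y - x)) ?_
    filter_upwards [self_mem_nhdsWithin] with t ht
    have ht : 0 < t := ht
    simp only [orient_lineMap, hx, mul_zero, zero_add]
    exact mul_ne_zero ht.ne' hy
  · exact subset_closure hx

theorem dense_generic (P : Finset Plane) : Dense {x | Generic P x} := by
  have : {x | Generic P x} = ⋂ pq ∈ {pq : Plane × Plane | pq.1 ∈ P ∧ pq.2 ∈ P ∧ pq.1 ≠ pq.2},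
      {x | orient pq.1 pq.2 x ≠ 0} := by
    ext x
    simp only [Generic, Set.mem_ofPred_eq, Set.mem_iInter, Prod.forall]
    exact ⟨fun h p q ⟨hp, hq, hpq⟩ => h p hp q hq hpq, fun h p hp q hq hpq => h p q ⟨hp, hq, hpq⟩⟩
  rw [this]
  refine dense_biInter_of_isOpen (fun pq _ => ?_) ?_ (fun pq hpq => dense_orient_ne_zero hpq.2.2)
  · exact isOpen_ne_fun (continuous_orient _ _) continuous_const
  · refine (((P ×ˢ P).finite_toSet).subset ?_).countable
    rintro ⟨p, q⟩ ⟨hp, hq, -⟩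
    simp [hp, hq]

theorem isCompact_hull (P : Finset Plane) : IsCompact (convexHull ℝ (P : Set Plane)) :=
  P.finite_toSet.isCompact_convexHull ℝ

theorem isClosed_hull (P : Finset Plane) : IsClosed (convexHull ℝ (P : Set Plane)) :=
  (isCompact_hull P).isClosed

/-- Separation puts `P` in an open half-plane bounded by a line through `x`. The right tangent from
`x` touches `P` at `a`; turning it about `a` until it meets the next point `b` gives a hull edge
with `x` outside. Genericity rules out ties on the tangent. -/
theorem exists_hullEdge_of_generic (hP : OrientGeneral P) (h3 : 2 < P.card) (hx : Generic P x)
    (hxP : x ∉ convexHull ℝ (P : Set Plane)) : ∃ a b, HullEdge P a b ∧ orient a b x < 0 := by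
  have hx' : x ∉ P := fun h => hxP (subset_convexHull ℝ _ h)
  obtain ⟨f, u, hfx, hfP⟩ :=
    geometric_hahn_banach_point_closed (convex_convexHull ℝ _) (isClosed_hull P) hxP
  have hf : ∀ y : Plane, f y = y 0 * f !₂[1, 0] + y 1 * f !₂[0, 1] := by
    intro y
    conv_lhs => rw [show y = y 0 • (!₂[1, 0] : Plane) + y 1 • (!₂[0, 1] : Plane) by
      ext i; fin_cases i <;> simp]
    rw [map_add, map_smul, map_smul, smul_eq_mul, smul_eq_mul]
  -- The vector added to `x` directs the level line of `f`, and this orientation equals `f p - f x`.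
  have hpos : ∀ p ∈ P, 0 < orient x (x + !₂[f !₂[0, 1], -f !₂[1, 0]]) p := by
    intro p hp
    have h1 := hfP p (subset_convexHull ℝ _ hp)
    have h2 := hf p
    have h3 := hf x
    simp [orient]
    linarith
  have hPne : P.Nonempty := Finset.card_pos.1 (by omega)
  obtain ⟨a, ha, hmin⟩ := exists_rightmost hPne hpos
  have hmin' : ∀ p ∈ P.erase a, 0 < orient a (a + (a - x)) p := by
    intro p hp
    obtain ⟨hpa, hp⟩ := Finset.mem_erase.1 hp
    rw [orient_reflect]
    refine lt_of_le_of_ne (hmin p hp) fun h0 => hx a ha p hp hpa.symm ?_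
    rw [orient_rotate x a p]
    exact h0.symm
  obtain ⟨p, hp, hpa, -⟩ := exists_third h3 a a
  obtain ⟨b, hb, hmax⟩ := exists_leftmost ⟨p, Finset.mem_erase.2 ⟨hpa, hp⟩⟩ hmin'
  have hb' := hmin' b hb
  obtain ⟨hba, hb⟩ := Finset.mem_erase.1 hb
  refine ⟨b, a, ⟨hb, ha, hba, fun q hq hqb hqa => ?_⟩, ?_⟩
  · refine hP.pos_of_nonneg hb ha hq hba hqb.symm hqa.symm ?_
    rw [orient_swap]
    linarith [hmax q (Finset.mem_erase.2 ⟨hqa, hq⟩)]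
  · rw [orient_reflect] at hb'
    simp only [orient] at hb' ⊢
    linarith

theorem exists_three (h3 : 2 < P.card) (hP : OrientGeneral P) :
    ∃ p ∈ P, ∃ q ∈ P, ∃ r ∈ P, 0 < orient p q r := by
  obtain ⟨p, hp, q, hq, r, hr, hpq, hpr, hqr⟩ := Finset.two_lt_card.1 h3
  rcases lt_or_gt_of_ne (hP p hp q hq r hr hpq hpr hqr) with h | h
  · exact ⟨q, hq, p, hp, r, hr, by rw [orient_swap]; linarith⟩
  · exact ⟨p, hp, q, hq, r, hr, h⟩

/-- Some point lies strictly to the left of all hull edges. -/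
theorem exists_center (h3 : 2 < P.card) (hP : OrientGeneral P) :
    ∃ o, ∀ a b, HullEdge P a b → 0 < orient a b o := by
  obtain ⟨p, hp, q, hq, r, hr, h⟩ := exists_three h3 hP
  obtain ⟨o, ho, -⟩ := exists_common_inside h h
  exact ⟨o, fun a b hab => hab.inside_pos hp hq hr ho⟩

theorem finite_hullEdges (P : Finset Plane) : {e : Plane × Plane | HullEdge P e.1 e.2}.Finite :=
  ((P ×ˢ P).finite_toSet).subset fun e he => by
    simp [he.left_mem, he.right_mem]

theorem isOpen_hullEdges_pos (P : Finset Plane) :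
    IsOpen {x | ∀ a b, HullEdge P a b → 0 < orient a b x} := by
  have : {x | ∀ a b, HullEdge P a b → 0 < orient a b x} =
      ⋂ e ∈ {e : Plane × Plane | HullEdge P e.1 e.2}, {x | 0 < orient e.1 e.2 x} := by
    ext x
    simp
  rw [this]
  exact (finite_hullEdges P).isOpen_biInter fun e _ => isOpen_orient_pos _ _

theorem HullEdge.nonneg_of_mem_hull (h : HullEdge P a b)
    (hx : x ∈ convexHull ℝ (P : Set Plane)) : 0 ≤ orient a b x :=
  convexHull_min (fun _ hp => h.nonneg hp) (convex_orient_nonneg a b) hx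

/-- The convex hull is the intersection of the half-planes to the left of the hull edges. -/
theorem mem_hull_iff (hP : OrientGeneral P) (h3 : 2 < P.card) :
    x ∈ convexHull ℝ (P : Set Plane) ↔ ∀ a b, HullEdge P a b → 0 ≤ orient a b x := by
  refine ⟨fun hx a b hab => hab.nonneg_of_mem_hull hx, fun hx => ?_⟩
  by_contra hxP
  -- A small move towards the centre makes all inequalities strict while staying outside the closed
  -- hull. Both conditions are open, so they hold at a generic point, which has a hull edge
  -- separating it.
  obtain ⟨o, ho⟩ := exists_center h3 hP
  obtain ⟨t, ht1, ht2, ht⟩ := ((tendsto_add_smul x (o - x)).eventually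
    ((isClosed_hull P).isOpen_compl.mem_nhds hxP) |>.and
    ((Ioo_mem_nhdsGT (zero_lt_one' ℝ)))).exists
  have hopen := (isClosed_hull P).isOpen_compl.inter (isOpen_hullEdges_pos P)
  obtain ⟨y, ⟨hy1, hy2⟩, hy⟩ := (dense_generic P).inter_open_nonempty _ hopen
    ⟨x + t • (o - x), ht1, fun a b hab => by
      rw [orient_lineMap]
      have h1 := mul_nonneg (sub_nonneg.2 ht.le) (hx a b hab)
      have h2 := mul_pos ht2 (ho a b hab)
      linarith⟩
  obtain ⟨a, b, hab, hneg⟩ := exists_hullEdge_of_generic hP h3 hy hy1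
  exact (hy2 a b hab).not_gt hneg

theorem mem_interior_hull_iff (hP : OrientGeneral P) (h3 : 2 < P.card) :
    x ∈ interior (convexHull ℝ (P : Set Plane)) ↔ ∀ a b, HullEdge P a b → 0 < orient a b x := by
  constructor
  · intro hx a b hab
    obtain ⟨o, ho⟩ := exists_center h3 hP
    refine lt_of_le_of_ne (hab.nonneg_of_mem_hull (interior_subset hx)) fun h0 => ?_
    -- An interior point on the line of a hull edge could be moved slightly away from `o` within the
    -- hull, to the wrong side of that edge.
    obtain ⟨t, ht1, ht2⟩ := ((tendsto_add_smul x (x - o)).eventually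
      (mem_interior_iff_mem_nhds.1 hx) |>.and self_mem_nhdsWithin).exists
    have ht2 : 0 < t := ht2
    have h1 := hab.nonneg_of_mem_hull ht1
    have h2 : orient a b (x + t • (x - o)) = -(t * orient a b o) := by
      rw [show x + t • (x - o) = x + (-t) • (o - x) by module, orient_lineMap, ← h0]
      ring
    have h3 := mul_pos ht2 (ho a b hab)
    linarith
  · intro hx
    exact interior_maximal (fun y hy => (mem_hull_iff hP h3).2 fun a b hab => (hy a b hab).le)
      (isOpen_hullEdges_pos P) hx

theorem mem_CH_iff (hP : OrientGeneral P) (h3 : 2 < P.card) :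
    x ∈ CH P ↔ x ∈ convexHull ℝ (P : Set Plane) ∧ ∃ a b, HullEdge P a b ∧ orient a b x = 0 := by
  rw [CH, (isClosed_hull P).frontier_eq, Set.mem_sdiff, mem_interior_hull_iff hP h3]
  refine and_congr_right fun hx => ?_
  push Not
  refine exists_congr fun a => exists_congr fun b => and_congr_right fun hab => ?_
  exact ⟨fun h => le_antisymm h (hab.nonneg_of_mem_hull hx), fun h => h.le⟩

theorem orient_eq_zero_of_mem_segment (hx : x ∈ segment ℝ a b) : orient a b x = 0 := by
  obtain ⟨s, t, -, -, hst, rfl⟩ := hx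
  rw [orient_convexCombination _ _ _ _ hst]
  simp

theorem segment_subset_hull (ha : a ∈ P) (hb : b ∈ P) :
    segment ℝ a b ⊆ convexHull ℝ (P : Set Plane) :=
  segment_subset_convexHull ha hb

theorem HullEdge.segment_subset_CH (hP : OrientGeneral P) (h3 : 2 < P.card)
    (hab : HullEdge P a b) : segment ℝ a b ⊆ CH P := fun _ hx =>
  (mem_CH_iff hP h3).2 ⟨segment_subset_hull hab.left_mem hab.right_mem hx, a, b, hab,
    orient_eq_zero_of_mem_segment hx⟩

/-- The neighbouring hull edges at `a` and at `b` cut the line `ab` down to the segment. -/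
theorem exists_segment_of_mem_CH (hP : OrientGeneral P) (h3 : 2 < P.card) (hx : x ∈ CH P) :
    ∃ a b, HullEdge P a b ∧ x ∈ segment ℝ a b := by
  obtain ⟨hxP, a, b, hab, h0⟩ := (mem_CH_iff hP h3).1 hx
  refine ⟨a, b, hab, ?_⟩
  obtain ⟨t, rfl⟩ := exists_eq_lineMap_of_orient_eq_zero hab.ne h0
  obtain ⟨c, hca⟩ := hab.exists_prev hP (exists_third h3 _ _)
  obtain ⟨d, hbd⟩ := hab.exists_next hP (exists_third h3 _ _)
  have h1 := hca.nonneg_of_mem_hull hxP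
  have h2 := hbd.nonneg_of_mem_hull hxP
  rw [orient_lineMap, orient_right, mul_zero, zero_add] at h1
  rw [orient_lineMap, orient_left, mul_zero, add_zero] at h2
  have hcb : c ≠ b := by
    rintro rfl
    exact hab.asymm h3 hca
  have had : a ≠ d := by
    rintro rfl
    exact hab.asymm h3 hbd
  have k1 := hca.pos hab.right_mem hcb.symm hab.ne.symm
  have k2 := hbd.pos hab.left_mem hab.ne had
  refine ⟨1 - t, t, ?_, ?_, by ring, by module⟩
  · by_contra! h
    have := mul_neg_of_neg_of_pos h k2
    linarith
  · by_contra! h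
    have := mul_neg_of_neg_of_pos h k1
    linarith

theorem mem_hullPoints_iff (hP : OrientGeneral P) (h3 : 2 < P.card) :
    p ∈ hullPoints P ↔ HullVertex P p := by
  constructor
  · rintro ⟨hp, hpCH⟩
    obtain ⟨-, a, b, hab, h0⟩ := (mem_CH_iff hP h3).1 hpCH
    rcases hab.eq_or_of_nonpos hp h0.le with rfl | rfl
    exacts [hab.left, hab.right]
  · intro h
    refine ⟨h.mem, ?_⟩
    obtain ⟨b, h | h⟩ := h
    · exact h.segment_subset_CH hP h3 (left_mem_segment ℝ _ _)
    · exact h.segment_subset_CH hP h3 (right_mem_segment ℝ _ _)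

theorem card_of_hullSize (h : 4 ≤ hullSize P) : 2 < P.card := by
  have h1 : hullPoints P ⊆ (P : Set Plane) := fun p hp => hp.1
  have h2 := Set.ncard_le_ncard h1 P.finite_toSet
  rw [Set.ncard_coe_finset] at h2
  unfold hullSize at h
  omega

theorem hullNotTriangle_of_hullSize (hP : OrientGeneral P) (h : 4 ≤ hullSize P) :
    HullNotTriangle P := by
  have h3 := card_of_hullSize h
  intro a b c hab hbc hca
  have hsub : hullPoints P ⊆ (({a, b, c} : Finset Plane) : Set Plane) := by
    intro p hp
    rw [mem_hullPoints_iff hP h3] at hp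
    by_contra hne
    simp only [Finset.coe_insert, Finset.coe_singleton, Set.mem_insert_iff,
      Set.mem_singleton_iff, not_or] at hne
    obtain ⟨ha, hb, hc⟩ := hne
    exact hp.not_inside hab.left_mem hbc.left_mem hca.left_mem
      ⟨hab.pos hp.mem ha hb, hbc.pos hp.mem hb hc, hca.pos hp.mem hc ha⟩
  have h2 := Set.ncard_le_ncard hsub (Finset.finite_toSet _)
  rw [Set.ncard_coe_finset] at h2
  have h4 : ({a, b, c} : Finset Plane).card ≤ 3 := Finset.card_le_three
  unfold hullSize at h
  omega

end

/-! ### Connected components and complements of convex sets. -/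

theorem subset_of_disjoint_frontier {X : Type*} [TopologicalSpace X] {C U : Set X}
    (hC : IsPreconnected C) (hU : IsOpen U) (hd : Disjoint C (frontier U))
    (hne : (C ∩ U).Nonempty) : C ⊆ U := by
  refine hC.subset_left_of_subset_union hU isClosed_closure.isOpen_compl
    (Set.disjoint_compl_right_iff_subset.2 subset_closure) (fun x hx => ?_) hne
  by_contra hcon
  simp only [Set.mem_union, Set.mem_compl_iff, not_or, not_not] at hcon
  refine Set.disjoint_left.1 hd hx ?_
  rw [hU.frontier_eq]
  exact ⟨hcon.2, hcon.1⟩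

theorem connectedComponentIn_eq_of_frontier {X : Type*} [TopologicalSpace X] {S U : Set X} {x : X}
    (hU : IsOpen U) (hU' : IsPreconnected U) (hx : x ∈ U) (hUS : U ⊆ S)
    (hfr : frontier U ⊆ Sᶜ) : connectedComponentIn S x = U := by
  refine Set.Subset.antisymm ?_ (hU'.subset_connectedComponentIn hx hUS)
  refine subset_of_disjoint_frontier isPreconnected_connectedComponentIn hU ?_
    ⟨x, mem_connectedComponentIn (hUS hx), hx⟩
  exact Set.disjoint_left.2 fun y hy hy' => hfr hy' (connectedComponentIn_subset _ _ hy)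

/-- The complement of a bounded convex set in the plane is connected. -/
theorem isPreconnected_compl_of_convex {K : Set Plane} (hK : Convex ℝ K)
    (hb : Bornology.IsBounded K) {o : Plane} (ho : o ∈ K) : IsPreconnected Kᶜ := by
  obtain ⟨R, hR0, hR⟩ : ∃ R : ℝ, 0 < R ∧ K ⊆ Metric.closedBall o R := by
    obtain ⟨R, hR⟩ := hb.subset_closedBall o
    exact ⟨max R 1, lt_of_lt_of_le one_pos (le_max_right _ _),
      hR.trans (Metric.closedBall_subset_closedBall (le_max_left _ _))⟩
  -- Since `‖f v - o‖ = R + ‖v‖`, this maps the connected punctured plane outside the ball. A point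
  -- off `K` reaches the image along its ray from `o`, which by convexity never returns to `K`.
  let f : Plane → Plane := fun v => o + (R / ‖v‖ + 1) • v
  have hf : ContinuousOn f {0}ᶜ := by
    refine continuousOn_const.add (ContinuousOn.smul (ContinuousOn.add (continuousOn_const.div
      continuous_norm.continuousOn fun v hv => norm_ne_zero_iff.2 hv) continuousOn_const)
      continuousOn_id)
  have hrank : 1 < Module.rank ℝ Plane := by
    rw [← Module.finrank_eq_rank, finrank_euclideanSpace_fin]
    norm_num
  have hS : IsPreconnected (f '' {0}ᶜ) :=
    (isConnected_compl_singleton_of_one_lt_rank hrank 0).isPreconnected.image f hf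
  have hSK : f '' {0}ᶜ ⊆ Kᶜ := by
    rintro _ ⟨v, hv, rfl⟩ hvK
    have h1 := hR hvK
    have hv' : 0 < ‖v‖ := norm_pos_iff.2 hv
    rw [Metric.mem_closedBall, dist_eq_norm] at h1
    simp only [f, add_sub_cancel_left, norm_smul, Real.norm_eq_abs] at h1
    rw [abs_of_pos (by positivity), add_mul, div_mul_cancel₀ _ hv'.ne'] at h1
    linarith
  have hray : ∀ x ∉ K, ∀ t : ℝ, 1 ≤ t → o + t • (x - o) ∉ K := by
    intro x hx t ht hxt
    apply hx
    have ht0 : 0 < t := by linarith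
    have := hK.add_smul_sub_mem ho hxt (t := t⁻¹) ⟨by positivity, inv_le_one_of_one_le₀ ht⟩
    rwa [add_sub_cancel_left, smul_smul, inv_mul_cancel₀ ht0.ne', one_smul,
      add_sub_cancel] at this
  obtain ⟨v₀, hv₀⟩ := (isConnected_compl_singleton_of_one_lt_rank hrank 0).nonempty
  refine isPreconnected_of_forall (f v₀) fun x hx => ?_
  have hxo : x - o ≠ 0 := by
    intro h
    rw [sub_eq_zero] at h
    exact hx (h ▸ ho)
  refine ⟨f '' {0}ᶜ ∪ (fun t : ℝ => o + t • (x - o)) '' Set.Ici 1, ?_, Or.inl ⟨v₀, hv₀, rfl⟩,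
    Or.inr ⟨1, Set.mem_Ici.2 le_rfl, by simp⟩, ?_⟩
  · rintro y (hy | ⟨t, ht, rfl⟩)
    · exact hSK hy
    · exact hray x hx t ht
  · refine IsPreconnected.union (f (x - o)) ⟨x - o, hxo, rfl⟩ ⟨R / ‖x - o‖ + 1, ?_, rfl⟩ hS
      (isPreconnected_Ici.image _ (by fun_prop))
    have := norm_pos_iff.2 hxo
    have : 0 < R / ‖x - o‖ := by positivity
    simp only [Set.mem_Ici]
    linarith

/-! ### From a face family to a noncomplex triangulation. -/

section

variable {P : Finset Plane} {F : Plane → Plane → Plane → Prop} {a b c d p q r x y z : Plane}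

theorem mem_segment_of_orient (h : 0 < orient a b c) (h0 : orient a b x = 0)
    (h1 : 0 ≤ orient b c x) (h2 : 0 ≤ orient c a x) : x ∈ segment ℝ a b := by
  obtain ⟨t, rfl⟩ := exists_eq_lineMap_of_orient_eq_zero (ne_of_orient_pos h).1 h0
  rw [orient_lineMap, orient_left, orient_rotate a b c] at h1
  rw [orient_lineMap, orient_right, ← orient_rotate c a b] at h2
  refine ⟨1 - t, t, ?_, ?_, by ring, by module⟩ <;> nlinarith

theorem inside_or_mem_segment (h : 0 < orient a b c) (h0 : 0 ≤ orient a b x)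
    (h1 : 0 ≤ orient b c x) (h2 : 0 ≤ orient c a x) :
    Inside a b c x ∨ x ∈ segment ℝ a b ∨ x ∈ segment ℝ b c ∨ x ∈ segment ℝ c a := by
  rcases h0.eq_or_lt with h0' | h0'
  · exact Or.inr (Or.inl (mem_segment_of_orient h h0'.symm h1 h2))
  rcases h1.eq_or_lt with h1' | h1'
  · refine Or.inr (Or.inr (Or.inl (mem_segment_of_orient (c := a) ?_ h1'.symm h2 h0)))
    rwa [orient_rotate]
  rcases h2.eq_or_lt with h2' | h2'
  · refine Or.inr (Or.inr (Or.inr (mem_segment_of_orient (c := b) ?_ h2'.symm h0 h1)))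
    rwa [← orient_rotate]
  exact Or.inl ⟨h0', h1', h2'⟩

theorem isOpen_inside (a b c : Plane) : IsOpen {x | Inside a b c x} :=
  (isOpen_orient_pos a b).inter ((isOpen_orient_pos b c).inter (isOpen_orient_pos c a))

theorem convex_inside (a b c : Plane) : Convex ℝ {x | Inside a b c x} :=
  (convex_orient_pos a b).inter ((convex_orient_pos b c).inter (convex_orient_pos c a))

theorem isClosed_triangle (a b c : Plane) :
    IsClosed {x | 0 ≤ orient a b x ∧ 0 ≤ orient b c x ∧ 0 ≤ orient c a x} :=
  (isClosed_orient_nonneg a b).inter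
    ((isClosed_orient_nonneg b c).inter (isClosed_orient_nonneg c a))

/-- The open triangle is the interior of the closed one. -/
theorem interior_triangleRegion (h : 0 < orient a b c) :
    interior (triangleRegion a b c) = {x | Inside a b c x} := by
  obtain ⟨hab, hbc, hca⟩ := ne_of_orient_pos h
  have hcoe : ({a, b, c} : Set Plane) = (({a, b, c} : Finset Plane) : Set Plane) := by simp
  have h3 : 2 < ({a, b, c} : Finset Plane).card := by
    rw [Finset.card_eq_three.2 ⟨a, b, c, hab, hca.symm, hbc, rfl⟩]
    norm_num
  have h' : 0 < orient b c a := by rwa [orient_rotate]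
  have h'' : 0 < orient c a b := by rwa [← orient_rotate]
  have hG : OrientGeneral {a, b, c} := by
    intro x hx y hy z hz hxy hxz hyz h0
    simp only [Finset.mem_insert, Finset.mem_singleton] at hx hy hz
    rcases hx with rfl | rfl | rfl <;> rcases hy with rfl | rfl | rfl <;>
      rcases hz with rfl | rfl | rfl <;>
      first | contradiction | (simp only [orient] at h h0; linarith)
  have e1 : HullEdge {a, b, c} a b := ⟨by simp, by simp, hab, by simp; tauto⟩
  have e2 : HullEdge {a, b, c} b c := ⟨by simp, by simp, hbc, by simp; tauto⟩
  have e3 : HullEdge {a, b, c} c a := ⟨by simp, by simp, hca, by simp; tauto⟩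
  ext x
  rw [triangleRegion, hcoe, mem_interior_hull_iff hG h3]
  constructor
  · exact fun hx => ⟨hx _ _ e1, hx _ _ e2, hx _ _ e3⟩
  · rintro ⟨h1, h2, h3⟩ p q hpq
    have hp := hpq.left_mem
    simp only [Finset.mem_insert, Finset.mem_singleton] at hp
    rcases hp with rfl | rfl | rfl
    · rwa [← e1.right_unique hpq]
    · rwa [← e2.right_unique hpq]
    · rwa [← e3.right_unique hpq]

theorem frontier_inside (h : 0 < orient a b c) :
    frontier {x | Inside a b c x} = frontier (triangleRegion a b c) := by
  obtain ⟨o, ho, -⟩ := exists_common_inside h h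
  have hconv : Convex ℝ (triangleRegion a b c) := convex_convexHull ℝ _
  rw [← interior_triangleRegion h, frontier, interior_interior,
    hconv.closure_interior_eq_closure_of_nonempty_interior
      ⟨o, by rw [interior_triangleRegion h]; exact ho⟩, frontier]

theorem frontier_inside_subset (h : 0 < orient a b c) :
    frontier {x | Inside a b c x} ⊆ segment ℝ a b ∪ (segment ℝ b c ∪ segment ℝ c a) := by
  intro x hx
  rw [(isOpen_inside a b c).frontier_eq] at hx
  have hsub : {x | Inside a b c x} ⊆
      {x | 0 ≤ orient a b x ∧ 0 ≤ orient b c x ∧ 0 ≤ orient c a x} :=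
    fun y hy => ⟨hy.1.le, hy.2.1.le, hy.2.2.le⟩
  have := closure_minimal hsub (isClosed_triangle a b c) hx.1
  exact (inside_or_mem_segment h this.1 this.2.1 this.2.2).resolve_left hx.2

namespace IsFaceFamily

/-- No edge enters the interior of a face. -/
theorem not_inside_of_mem_segment (hF : IsFaceFamily P F) (hf : F a b c) (he : Edge F p q)
    (hz : z ∈ segment ℝ p q) : ¬ Inside a b c z := by
  have key : ∀ {p q r}, F p q r → z ∈ segment ℝ p q → ¬ Inside a b c z := by
    intro p q r hpq hz hin
    have hpos := hF.orient_pos hpq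
    have hz0 := orient_eq_zero_of_mem_segment hz
    have hzp : z ≠ p := by
      rintro rfl
      exact hF.empty hf _ (hF.mem hpq) hin
    have hzq : z ≠ q := by
      rintro rfl
      exact hF.empty hf _ (hF.mem (hF.rotate hpq)) hin
    obtain ⟨t, ⟨ht0, ht1⟩, rfl⟩ := (segment_eq_image' ℝ p q).subset hz
    have ht0 : 0 < t := lt_of_le_of_ne ht0 (by rintro rfl; simp at hzp)
    have ht1 : t < 1 := lt_of_le_of_ne ht1 (by rintro rfl; simp at hzq)
    set z := p + t • (q - p) with hzdef
    have h1 : 0 < orient q r z := by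
      rw [hzdef, orient_lineMap, orient_left, orient_rotate p q r]
      have := mul_pos (sub_pos.2 ht1) hpos
      linarith
    have h2 : 0 < orient r p z := by
      rw [hzdef, orient_lineMap, orient_right, ← orient_rotate r p q]
      have := mul_pos ht0 hpos
      linarith
    -- Pushing `z` slightly towards `r` lands in both faces. They then coincide, although `z` is
    -- inside one and on a side of the other.
    obtain ⟨s, hs1, hs2, hs3, hs⟩ := ((tendsto_add_smul z (r - z)).eventually
      ((isOpen_inside a b c).mem_nhds hin) |>.and ((eventually_pos_of_pos h1 (orient q r r)).and
      ((eventually_pos_of_pos h2 (orient r p r)).and self_mem_nhdsWithin))).exists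
    have hs : 0 < s := hs
    have hin' : Inside p q r (z + s • (r - z)) := by
      refine ⟨?_, ?_, ?_⟩
      · rw [orient_lineMap, hz0]
        have := mul_pos hs hpos
        linarith
      · rwa [orient_lineMap]
      · rwa [orient_lineMap]
    rcases hF.disjoint hf hpq hs1 hin' with ⟨rfl, rfl, -⟩ | ⟨rfl, rfl, -⟩ | ⟨rfl, rfl, -⟩
    · exact hin.1.ne' hz0
    · exact hin.2.1.ne' hz0
    · exact hin.2.2.ne' hz0
  obtain ⟨r, h | h⟩ := he
  · exact key h hz
  · exact key h (segment_symm ℝ p q ▸ hz)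

theorem eq_or_of_mem_segment (hF : IsFaceFamily P F) (hP : OrientGeneral P) (he : Edge F a b)
    (hp : p ∈ P) (h : p ∈ segment ℝ a b) : p = a ∨ p = b := by
  by_contra! hne
  exact hP a (hF.mem_left he) b (hF.mem_right he) p hp (hF.ne he) hne.1.symm hne.2.symm
    (orient_eq_zero_of_mem_segment h)

theorem eq_of_common_vertex (hF : IsFaceFamily P F) (hP : OrientGeneral P) (hb : Edge F a b)
    (hd : Edge F a d) (hbd : b ≠ d) (h1 : x ∈ segment ℝ a b) (h2 : x ∈ segment ℝ a d) :
    x = a := by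
  have h0 := orient_eq_zero_of_mem_segment h2
  obtain ⟨t, -, rfl⟩ := (segment_eq_image' ℝ a b).subset h1
  rw [orient_lineMap, orient_left, mul_zero, zero_add] at h0
  rcases mul_eq_zero.1 h0 with rfl | h0
  · simp
  · exact absurd h0 (hP a (hF.mem_left hb) d (hF.mem_right hd) b (hF.mem_right hb) (hF.ne hd)
      (hF.ne hb) hbd.symm)

/-- Edges without a common endpoint are disjoint. -/
theorem segments_disjoint (hF : IsFaceFamily P F) (hP : OrientGeneral P) (hab : Edge F a b)
    (hcd : Edge F c d) (hac : a ≠ c) (had : a ≠ d) (hbc : b ≠ c) (hbd : b ≠ d)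
    (h1 : x ∈ segment ℝ a b) : x ∉ segment ℝ c d := by
  have key : ∀ {a b p c d x}, F a b p → Edge F c d → a ≠ c → a ≠ d → b ≠ c → b ≠ d →
      x ∈ segment ℝ a b → x ∈ segment ℝ c d → 0 < orient a b d → False := by
    intro a b p c d x hf hcd hac had hbc hbd h1 h2 hd
    have hab : Edge F a b := ⟨p, Or.inl hf⟩
    have h0 := orient_eq_zero_of_mem_segment h1
    have hxa : x ≠ a := by
      rintro rfl
      exact (hF.eq_or_of_mem_segment hP hcd (hF.mem_left hab) h2).elim hac had
    have hxb : x ≠ b := by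
      rintro rfl
      exact (hF.eq_or_of_mem_segment hP hcd (hF.mem_right hab) h2).elim hbc hbd
    obtain ⟨t, ⟨ht0, ht1⟩, rfl⟩ := (segment_eq_image' ℝ a b).subset h1
    have ht0 : 0 < t := lt_of_le_of_ne ht0 (by rintro rfl; simp at hxa)
    have ht1 : t < 1 := lt_of_le_of_ne ht1 (by rintro rfl; simp at hxb)
    set x := a + t • (b - a) with hxdef
    have hpos := hF.orient_pos hf
    have k1 : 0 < orient b p x := by
      rw [hxdef, orient_lineMap, orient_left, orient_rotate a b p]
      have := mul_pos (sub_pos.2 ht1) hpos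
      linarith
    have k2 : 0 < orient p a x := by
      rw [hxdef, orient_lineMap, orient_right, ← orient_rotate p a b]
      have := mul_pos ht0 hpos
      linarith
    -- From the crossing point, a short step along `cd` towards `d` enters the face `abp`, which no
    -- edge may do.
    obtain ⟨s, hs1, hs2, hs⟩ := ((eventually_pos_of_pos k1 (orient b p d)).and
      ((eventually_pos_of_pos k2 (orient p a d)).and (Ioo_mem_nhdsGT (zero_lt_one' ℝ)))).exists
    refine hF.not_inside_of_mem_segment hf hcd (z := x + s • (d - x)) ?_ ⟨?_, ?_, ?_⟩
    · exact (convex_segment c d).add_smul_sub_mem h2 (right_mem_segment ℝ c d) ⟨hs.1.le, hs.2.le⟩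
    · rw [orient_lineMap, h0]
      have := mul_pos hs.1 hd
      linarith
    · rwa [orient_lineMap]
    · rwa [orient_lineMap]
  have key' : ∀ {a b p}, F a b p → a ≠ c → a ≠ d → b ≠ c → b ≠ d →
      x ∈ segment ℝ a b → x ∉ segment ℝ c d := by
    intro a b p hf hac had hbc hbd h1 h2
    have hab : Edge F a b := ⟨p, Or.inl hf⟩
    rcases lt_or_gt_of_ne (hP a (hF.mem_left hab) b (hF.mem_right hab) d (hF.mem_right hcd)
      (hF.ne hab) had hbd) with hd | hd
    · rcases lt_or_gt_of_ne (hP a (hF.mem_left hab) b (hF.mem_right hab) c (hF.mem_left hcd)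
        (hF.ne hab) hac hbc) with hc | hc
      · have h0 := orient_eq_zero_of_mem_segment h1
        obtain ⟨s, t, hs, ht, hst, rfl⟩ := h2
        rw [orient_convexCombination _ _ _ _ hst] at h0
        have e1 := mul_nonpos_of_nonneg_of_nonpos hs hc.le
        have e2 := mul_nonpos_of_nonneg_of_nonpos ht hd.le
        have e3 := (mul_eq_zero.1 (by linarith : s * orient a b c = 0)).resolve_right hc.ne
        have e4 := (mul_eq_zero.1 (by linarith : t * orient a b d = 0)).resolve_right hd.ne
        linarith
      · exact key hf hcd.symm had hac hbd hbc h1 (segment_symm ℝ c d ▸ h2) hc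
    · exact key hf hcd hac had hbc hbd h1 h2 hd
  obtain ⟨p, hf | hf⟩ := hab
  · exact key' hf hac had hbc hbd h1
  · exact key' hf hbc hbd hac had (segment_symm ℝ a b ▸ h1)

/-- The graph formed by the edges of the faces. -/
def graph (hF : IsFaceFamily P F) : SimpleGraph P where
  Adj p q := Edge F p q
  symm := ⟨fun _ _ h => h.symm⟩
  loopless := ⟨fun _ h => hF.ne h rfl⟩

theorem isPlane (hF : IsFaceFamily P F) (hP : OrientGeneral P) : IsPlane P hF.graph := by
  refine ⟨fun a b hab p hp => ?_, ?_⟩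
  · simpa only [Subtype.ext_iff] using hF.eq_or_of_mem_segment hP hab p.2 hp
  · rintro ⟨a, ha⟩ ⟨b, hb⟩ ⟨c, hc⟩ ⟨d, hd⟩ hab hcd hne x h1 h2
    replace hab : Edge F a b := hab
    replace hcd : Edge F c d := hcd
    simp only [ne_eq, Sym2.eq_iff, Subtype.mk.injEq, not_or, not_and] at hne h1 h2 ⊢
    have h1' : x ∈ segment ℝ b a := segment_symm ℝ a b ▸ h1
    have h2' : x ∈ segment ℝ d c := segment_symm ℝ c d ▸ h2
    by_cases hac : a = c
    · subst hac
      have := hF.eq_of_common_vertex hP hab hcd (hne.1 rfl) h1 h2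
      exact ⟨Or.inl this, Or.inl this⟩
    by_cases had : a = d
    · subst had
      have := hF.eq_of_common_vertex hP hab hcd.symm (hne.2 rfl) h1 h2'
      exact ⟨Or.inl this, Or.inr this⟩
    by_cases hbc : b = c
    · subst hbc
      have := hF.eq_of_common_vertex hP hab.symm hcd had h1' h2
      exact ⟨Or.inr this, Or.inl this⟩
    by_cases hbd : b = d
    · subst hbd
      have := hF.eq_of_common_vertex hP hab.symm hcd.symm hac h1' h2'
      exact ⟨Or.inr this, Or.inr this⟩
    exact absurd h2 (hF.segments_disjoint hP hab hcd hac had hbc hbd h1)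

theorem segment_subset_drawing (hF : IsFaceFamily P F) (h : Edge F a b) :
    segment ℝ a b ⊆ drawing P hF.graph := fun _ hx =>
  Or.inr ⟨⟨a, hF.mem_left h⟩, ⟨b, hF.mem_right h⟩, h, hx⟩

theorem notMem_drawing_of_inside (hF : IsFaceFamily P F) (hf : F a b c) (hx : Inside a b c x) :
    x ∉ drawing P hF.graph := by
  rintro (h | ⟨p, q, hpq, h⟩)
  · exact hF.empty hf x h hx
  · exact hF.not_inside_of_mem_segment hf hpq h hx

theorem CH_subset_drawing (hF : IsFaceFamily P F) (hP : OrientGeneral P) (h3 : 2 < P.card) :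
    CH P ⊆ drawing P hF.graph := by
  intro x hx
  obtain ⟨a, b, hab, hx⟩ := exists_segment_of_mem_CH hP h3 hx
  obtain ⟨c, hc⟩ := hF.hull hab
  exact hF.segment_subset_drawing ⟨c, Or.inl hc⟩ hx

theorem drawing_subset_hull (T : SimpleGraph P) :
    drawing P T ⊆ convexHull ℝ (P : Set Plane) := by
  rintro x (h | ⟨p, q, -, h⟩)
  · exact subset_convexHull ℝ _ h
  · exact segment_subset_hull p.2 q.2 h

/-- The faces cover the convex hull off the drawing. -/
theorem exists_inside (hF : IsFaceFamily P F) (hP : OrientGeneral P) (h3 : 2 < P.card)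
    (hx : x ∈ convexHull ℝ (P : Set Plane)) (hx' : x ∉ drawing P hF.graph) :
    ∃ a b c, F a b c ∧ Inside a b c x := by
  let K : Set Plane := ⋃ t ∈ {t : Plane × Plane × Plane | F t.1 t.2.1 t.2.2},
    {x | 0 ≤ orient t.1 t.2.1 x ∧ 0 ≤ orient t.2.1 t.2.2 x ∧ 0 ≤ orient t.2.2 t.1 x}
  have hKc : IsClosed K := by
    refine Set.Finite.isClosed_biUnion (((P ×ˢ P ×ˢ P).finite_toSet).subset ?_)
      fun t _ => isClosed_triangle _ _ _
    rintro ⟨a, b, c⟩ h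
    have h : F a b c := h
    simp [hF.mem h, hF.mem (hF.rotate h), hF.mem (hF.rotate (hF.rotate h))]
  have hxi : ∀ a b, HullEdge P a b → 0 < orient a b x := by
    rw [← mem_interior_hull_iff hP h3]
    by_contra hcon
    refine hx' (hF.CH_subset_drawing hP h3 ?_)
    rw [CH, (isClosed_hull P).frontier_eq]
    exact ⟨hx, hcon⟩
  -- The closed faces form a closed set containing the dense generic points of the hull's interior,
  -- hence all of that interior.
  have hxK : x ∈ K := by
    by_contra hxK
    obtain ⟨y, ⟨hy1, hy2⟩, hy⟩ := (dense_generic P).inter_open_nonempty _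
      ((isOpen_hullEdges_pos P).inter hKc.isOpen_compl) ⟨x, hxi, hxK⟩
    obtain ⟨a, b, c, hf, hin⟩ := hF.cover y hy hy1
    refine hy2 (Set.mem_biUnion (x := (a, b, c)) hf ?_)
    exact ⟨hin.1.le, hin.2.1.le, hin.2.2.le⟩
  simp only [K, Set.mem_iUnion] at hxK
  obtain ⟨⟨a, b, c⟩, hf, h1, h2, h4⟩ := hxK
  have hf : F a b c := hf
  refine ⟨a, b, c, hf, ?_⟩
  rcases inside_or_mem_segment (hF.orient_pos hf) h1 h2 h4 with h | h | h | h
  · exact h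
  · exact absurd (hF.segment_subset_drawing ⟨c, Or.inl hf⟩ h) hx'
  · exact absurd (hF.segment_subset_drawing ⟨a, Or.inl (hF.rotate hf)⟩ h) hx'
  · exact absurd (hF.segment_subset_drawing ⟨b, Or.inl (hF.rotate (hF.rotate hf))⟩ h) hx'

/-- The open triangle is connected, misses the drawing and has its frontier in the drawing, so it is
a full component. -/
theorem component_eq_inside (hF : IsFaceFamily P F) (hf : F a b c) (hx : Inside a b c x) :
    connectedComponentIn (drawing P hF.graph)ᶜ x = {x | Inside a b c x} := by
  refine connectedComponentIn_eq_of_frontier (isOpen_inside a b c)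
    (convex_inside a b c).isPreconnected hx (fun y hy => hF.notMem_drawing_of_inside hf hy) ?_
  rw [compl_compl]
  refine (frontier_inside_subset (hF.orient_pos hf)).trans (Set.union_subset ?_
    (Set.union_subset ?_ ?_))
  · exact hF.segment_subset_drawing ⟨c, Or.inl hf⟩
  · exact hF.segment_subset_drawing ⟨a, Or.inl (hF.rotate hf)⟩
  · exact hF.segment_subset_drawing ⟨b, Or.inl (hF.rotate (hF.rotate hf))⟩

theorem component_eq_compl_hull (hF : IsFaceFamily P F) (hP : OrientGeneral P) (h3 : 2 < P.card)
    (hx : x ∉ convexHull ℝ (P : Set Plane)) :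
    connectedComponentIn (drawing P hF.graph)ᶜ x = (convexHull ℝ (P : Set Plane))ᶜ := by
  obtain ⟨p, hp, -⟩ := exists_third h3 x x
  refine connectedComponentIn_eq_of_frontier (isClosed_hull P).isOpen_compl
    (isPreconnected_compl_of_convex (convex_convexHull ℝ _) (isCompact_hull P).isBounded
      (subset_convexHull ℝ _ hp)) hx (Set.compl_subset_compl.2 (drawing_subset_hull _)) ?_
  rw [compl_compl, frontier_compl]
  exact hF.CH_subset_drawing hP h3

theorem not_isBounded_compl_hull (P : Finset Plane) :
    ¬ Bornology.IsBounded (convexHull ℝ (P : Set Plane))ᶜ := by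
  intro h
  have := (isCompact_hull P).isBounded.union h
  rw [Set.union_compl_self] at this
  exact NormedSpace.unbounded_univ ℝ Plane this

theorem isBounded_inside (h : 0 < orient a b c) :
    Bornology.IsBounded {x | Inside a b c x} := by
  rw [← interior_triangleRegion h]
  exact (isBounded_convexHull.2 (Set.toFinite _).isBounded).subset interior_subset

theorem isTriangulation (hF : IsFaceFamily P F) (hP : OrientGeneral P) (h3 : 2 < P.card) :
    IsTriangulation P hF.graph := by
  refine ⟨hF.isPlane hP, ?_, ?_⟩
  · rintro _ ⟨x, hx, rfl⟩ hb
    by_cases hxP : x ∈ convexHull ℝ (P : Set Plane)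
    · obtain ⟨a, b, c, hf, hin⟩ := hF.exists_inside hP h3 hxP hx
      rw [hF.component_eq_inside hf hin] at hb
      exact absurd (isBounded_inside (hF.orient_pos hf)) hb
    · rw [hF.component_eq_compl_hull hP h3 hxP, frontier_compl, CH]
  · rintro _ ⟨x, hx, rfl⟩ hb
    by_cases hxP : x ∈ convexHull ℝ (P : Set Plane)
    · obtain ⟨a, b, c, hf, hin⟩ := hF.exists_inside hP h3 hxP hx
      refine ⟨⟨a, hF.mem hf⟩, ⟨b, hF.mem (hF.rotate hf)⟩,
        ⟨c, hF.mem (hF.rotate (hF.rotate hf))⟩, ⟨⟨c, Or.inl hf⟩, ⟨a, Or.inl (hF.rotate hf)⟩,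
        ⟨b, Or.inr (hF.rotate (hF.rotate hf))⟩⟩, ?_⟩
      rw [hF.component_eq_inside hf hin]
      exact frontier_inside (hF.orient_pos hf)
    · rw [hF.component_eq_compl_hull hP h3 hxP] at hb
      exact absurd hb (not_isBounded_compl_hull P)

end IsFaceFamily

theorem HullEdge.consecutive (hP : OrientGeneral P) (h3 : 2 < P.card) (h : HullEdge P a b) :
    Consecutive P a b := by
  refine ⟨h.ne, h.segment_subset_CH hP h3, fun p hp hpab => ?_⟩
  exact h.eq_or_of_nonpos hp (orient_eq_zero_of_mem_segment hpab).le

theorem Consecutive.symm (h : Consecutive P a b) : Consecutive P b a := by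
  obtain ⟨h1, h2, h3⟩ := h
  rw [segment_symm] at h2 h3
  exact ⟨h1.symm, h2, fun p hp hpab => (h3 p hp hpab).symm⟩

theorem Consecutive.hullEdge (hP : OrientGeneral P) (h3 : 2 < P.card) (ha : a ∈ P) (hb : b ∈ P)
    (h : Consecutive P a b) : HullEdge P a b ∨ HullEdge P b a := by
  -- The midpoint lies on the line of some hull edge, and neither endpoint is to its right, so both
  -- are on that line.
  have hm : a + (1 / 2 : ℝ) • (b - a) ∈ segment ℝ a b :=
    (segment_eq_image' ℝ a b).symm.subset ⟨1 / 2, by norm_num, rfl⟩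
  obtain ⟨-, p, q, hpq, h0⟩ := (mem_CH_iff hP h3).1 (h.2.1 hm)
  rw [orient_lineMap] at h0
  have h1 := hpq.nonneg ha
  have h2 := hpq.nonneg hb
  have hne := h.1
  rcases hpq.eq_or_of_nonpos ha (by linarith) with rfl | rfl <;>
  rcases hpq.eq_or_of_nonpos hb (by linarith) with rfl | rfl
  · exact absurd rfl hne
  · exact Or.inl hpq
  · exact Or.inr hpq
  · exact absurd rfl hne

theorem triangleRegion_swap (a b c : Plane) : triangleRegion b a c = triangleRegion a b c := by
  rw [triangleRegion, Set.insert_comm, ← triangleRegion]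

/-- Every triangle of edges, once oriented counterclockwise, is a face and hence contains no point
of `P` in its interior. -/
theorem IsFaceFamily.isNoncomplex (hF : IsFaceFamily P F) (hP : OrientGeneral P)
    (h3 : 2 < P.card) : IsNoncomplex P hF.graph := by
  constructor
  · rintro a b ⟨hab, ha, hb, hcon⟩
    rw [mem_hullPoints_iff hP h3] at ha hb
    rcases hF.chord hab ha hb with h | h
    · exact hcon (h.consecutive hP h3)
    · exact hcon (h.consecutive hP h3).symm
  · have key : ∀ {a b c p}, Edge F a b → Edge F b c → Edge F c a → 0 < orient a b c → p ∈ P →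
        p ∉ interior (triangleRegion a b c) := by
      intro a b c p h1 h2 h3 h0 hp hin
      rw [interior_triangleRegion h0] at hin
      exact hF.empty (hF.triangle h1 h2 h3 h0) p hp hin
    rintro ⟨a, ha⟩ ⟨b, hb⟩ ⟨c, hc⟩ ⟨⟨hab, hbc, hac⟩, ⟨p, hp, hin⟩, -⟩
    replace hab : Edge F a b := hab
    replace hbc : Edge F b c := hbc
    replace hac : Edge F a c := hac
    rcases lt_or_gt_of_ne (hP a ha b hb c hc (hF.ne hab) (hF.ne hac) (hF.ne hbc)) with h | h
    · refine key hab.symm hac hbc.symm (by rw [orient_swap]; linarith) hp ?_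
      rwa [triangleRegion_swap]
    · exact key hab hbc hac.symm h hp hin

theorem isClosed_drawing (T : SimpleGraph P) : IsClosed (drawing P T) := by
  have : drawing P T = (P : Set Plane) ∪ ⋃ e ∈ {e : P × P | T.Adj e.1 e.2},
      segment ℝ (e.1 : Plane) (e.2 : Plane) := by
    ext x
    simp [drawing]
  rw [this]
  refine P.finite_toSet.isClosed.union (Set.Finite.isClosed_biUnion (Set.toFinite _) fun e _ => ?_)
  rw [segment_eq_image']
  exact (isCompact_Icc.image (by fun_prop)).isClosed

/-! ### Necessity of a point off the hull boundary. -/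

/-- A triangulation without chords of a point set whose hull is not a triangle has a vertex off the
boundary of the hull. -/
theorem exists_notMem_CH (hP : OrientGeneral P) (h3 : 2 < P.card) (hT : HullNotTriangle P)
    {T : SimpleGraph P} (hTr : IsTriangulation P T) (hchord : ∀ a b : P, ¬ IsChord P T a b) :
    ∃ p ∈ P, p ∉ CH P := by
  by_contra! hall
  have hcons : ∀ a b : P, T.Adj a b → Consecutive P a b := by
    intro a b hab
    by_contra hcon
    exact hchord a b ⟨hab, ⟨a.2, hall a a.2⟩, ⟨b.2, hall b b.2⟩, hcon⟩
  have hdraw : drawing P T ⊆ CH P := by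
    rintro x (hx | ⟨a, b, hab, hx⟩)
    · exact hall x hx
    · exact (hcons a b hab).2.1 hx
  obtain ⟨o, ho⟩ := exists_center h3 hP
  rw [← mem_interior_hull_iff hP h3] at ho
  have ho' : o ∈ (drawing P T)ᶜ := fun h => (hdraw h).2 ho
  set C := connectedComponentIn (drawing P T)ᶜ o with hC
  have hoC : o ∈ C := mem_connectedComponentIn ho'
  have hb : Bornology.IsBounded C := by
    -- If the face of `o` were unbounded, its frontier would be `CH P`. Being open, it misses its
    -- frontier, so it could not leave the hull's interior.
    by_contra hb
    have hfr := hTr.outer C ⟨o, ho', rfl⟩ hb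
    have hopen : IsOpen C := (isClosed_drawing T).isOpen_compl.connectedComponentIn
    refine hb ((isCompact_hull P).isBounded.subset ?_)
    refine (subset_of_disjoint_frontier isPreconnected_connectedComponentIn isOpen_interior ?_
      ⟨o, hoC, ho⟩).trans interior_subset
    refine Set.disjoint_left.2 fun x hx hx' => ?_
    have hx'' : x ∈ frontier C := by
      rw [hfr]
      exact frontier_interior_subset hx'
    rw [hopen.frontier_eq] at hx''
    exact hx''.2 hx
  obtain ⟨a, b, c, ⟨hab, hbc, hac⟩, -⟩ := hTr.inner C ⟨o, ho', rfl⟩ hb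
  have e1 := (hcons a b hab).hullEdge hP h3 a.2 b.2
  have e2 := (hcons b c hbc).hullEdge hP h3 b.2 c.2
  have e3 := (hcons a c hac).hullEdge hP h3 a.2 c.2
  have n1 : a ≠ b := hab.ne
  have n2 : b ≠ c := hbc.ne
  have n3 : a ≠ c := hac.ne
  rw [ne_eq, Subtype.ext_iff] at n1 n2 n3
  -- The three hull edges form a directed cycle, which is a triangular hull, or two of them share a
  -- head or a tail and coincide.
  rcases e1 with e1 | e1 <;> rcases e2 with e2 | e2 <;> rcases e3 with e3 | e3
  · exact n2 (e1.right_unique e3)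
  · exact hT _ _ _ e1 e2 e3
  · exact n3 (e1.left_unique e2)
  · exact n3 (e1.left_unique e2)
  · exact n3 (e1.right_unique e2)
  · exact n3 (e1.right_unique e2)
  · exact hT _ _ _ e3 e2 e1
  · exact n1 (e2.right_unique e3).symm

end

end PlanarPointSet

theorem mainTheorem4 (P : Finset Plane) (hP : PlanarPointSet.GeneralPosition P)
    (hCH : 4 ≤ PlanarPointSet.hullSize P) :
    PlanarPointSet.AdmitsNoncomplexTriangulation P ↔ ∃ p ∈ P, p ∉ PlanarPointSet.CH P := by
  have hG := hP.orientGeneral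
  have h3 := PlanarPointSet.card_of_hullSize hCH
  have hT := PlanarPointSet.hullNotTriangle_of_hullSize hG hCH
  constructor
  · rintro ⟨T, hTr, hN⟩
    exact PlanarPointSet.exists_notMem_CH hG h3 hT hTr hN.1
  · rintro ⟨u, hu, huCH⟩
    have hne : (PlanarPointSet.hullPoints P).Nonempty := by
      rw [← Set.ncard_pos (P.finite_toSet.subset fun p hp => hp.1)]
      exact lt_of_lt_of_le (by norm_num) hCH
    obtain ⟨a, ha⟩ := hne
    obtain ⟨b, hb⟩ := ((PlanarPointSet.mem_hullPoints_iff hG h3).1 ha).exists_next hG h3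
    obtain ⟨F, hF⟩ := PlanarPointSet.exists_isFaceFamily _ P rfl hG hT ⟨a, b, hb⟩
      ⟨u, hu, fun h => huCH ((PlanarPointSet.mem_hullPoints_iff hG h3).2 h).2⟩
    exact ⟨hF.graph, hF.isTriangulation hG h3, hF.isNoncomplex hG h3⟩
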